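/- Let $R$ be a two-sided noetherian ring, let $\mathcal K(R)$ be the homotopy category of (possibly unbounded) cochain complexes of finitely generated projective right $R$-modules, and let $(-)^*=\operatorname{Hom}_R(-,R)\colon\mathcal K(R)\to\mathcal K(R^{\mathrm{op}})$ be the $R$-dual. **Notation.** For $X\in\mathcal K(R)$ put $C^i(X)=\operatorname{Coker}(d_X^{i-1}\colon X^{i-1}\to X^i)$. A finitely generated module $M$ is *Gorenstein projective* if $\operatorname{Ext}^n_R(M,R)=0=\operatorname{Ext}^n_{R^{\mathrm{op}}}(\operatorname{Tr}M,R)$ for all $n>0$, where $\operatorname{Tr}M=\operatorname{Coker}(d_1^*)$ for a presentation $P_1\xrightarrow{d_1}P_0\to M\to0$ by finitely generated projective modules. A complex $X\in\mathcal K(R)$ is *Gorenstein projective* if all modules $C^i(X)$ are. The same definitions are used over $R^{\mathrm{op}}$. A complex $X$ is *split* if there are maps $s^i\colon X^i\to X^{i-1}$ with $d_X^is^{i+1}d_X^i=d_X^i$ for all $i$. The category $\operatorname{Add}R$ is the smallest full subcategory of $\mathcal K(R)$ that contains $R$ (in degree $0$) and is closed under shifts, direct summands and those coproducts that exist in $\mathcal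 K(R)$. A morphism $p\colon P\to X$ with $P\in\operatorname{Add}R$ is a *right $\operatorname{Add}R$-approximation* if every morphism $W\to X$ with $W\in\operatorname{Add}R$ factors through $p$; left approximations $q\colon X\to Q$ are defined dually. A *syzygy* $\Omega X$ is $\operatorname{Cone}(p)[-1]$ for a right $\operatorname{Add}R$-approximation $p$ of $X$, and a *cosyzygy* $\Omega^-X$ is $\operatorname{Cone}(q)$ for a left one $q$ (both up to isomorphism in $\mathcal K(R)$). A morphism $f$ is *cohomologically surjective* if $\mathrm H^i(f)$ is surjective for all $i$. A triangle $X\to Y\to Z\to X[1]$ is *cohomologically ghost* if $0\to\mathrm H^i(X)\to\mathrm H^i(Y)\to\mathrm H^i(Z)\to0$ is exact for all $i$. The *projective dimension* $\operatorname{pd}_RX\in\{0,1,2,\dots,\infty\}$ of a complex $X\in\mathcal K(R)$ is the infimum of the $n\ge0$ for which there are triangles $X_{i+1}\to P_i\xrightarrow{f_i}X_i\to X_{i+1}[1]$ in $\mathcal K(R)$, $0\le i\le n-1$, with $P_i$ split and $f_i$ cohomologically surjective, such that $X_0\cong X$ in $\mathcal K(R)$ and $X_n$ is split. The projective dimension $\operatorname{pd}_RM\in\{0,1,2,\dots,\infty\}$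 of a finitely generated module $M$ is the infimum of the $n\ge0$ for which there is an exact sequence $0\to P_n\to\cdots\to P_0\to M\to0$ with all $P_i$ finitely generated projective (so $\operatorname{pd}_R0=0$). **Proposition.** The following hold. 1. For every $X\in\mathcal K(R)$, $\operatorname{pd}_RX=\sup\{\operatorname{pd}_RC^i(X)\mid i\in\mathbb Z\}$. 2. If $X\in\mathcal K(R)$ is Gorenstein projective, then $\mathrm H^i(X)$ is a Gorenstein projective module for every integer $i$. 3. Let $X,Y,Z\in\mathcal K(R)$. - (a) Split complexes are Gorenstein projective. - (b) If $X$ is Gorenstein projective and $Y$ is a direct summand of $X$ in $\mathcal K(R)$, then $Y$ is Gorenstein projective. - (c) If $X$ is Gorenstein projective, then so is $X[n]$ for every integer $n$. - (d) If $X$ is Gorenstein projective, then so are $\Omega X$, $X^*$ and $\Omega^-X$ (for every choice of syzygy and cosyzygy). - (e) Let $X\to Y\to Z\to X[1]$ be a cohomologically ghost triangle in $\mathcal K(R)$ with $Z$ Gorenstein projective. Then $X$ is Gorenstein projective if and only if $Y$ is. -/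

import Mathlib

open CategoryTheory CategoryTheory.Limits CategoryTheory.Pretriangulated

universe u

noncomputable section

namespace StableComplex

open scoped ZeroObject

/-! Left modules over `A` form `ModuleCat A`; right modules over a ring `R` form
`ModuleCat Rᵐᵒᵖ`.  The constructions that involve the dual are set up for two rings `A`, `B`
and a module `D` over both with commuting actions.  Taking `(A, B, D) = (Rᵐᵒᵖ, R, R)` gives
right `R`-modules with their left `R`-module duals `Hom(-, R)`, and `(R, Rᵐᵒᵖ, R)` gives left
`R`-modules with their right `R`-module duals. -/

section Modules

variable {A : Type u} [Ring A]

/-- Finitely generated projective modules. -/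
def IsFGProj (M : ModuleCat.{u} A) : Prop :=
  Module.Finite A M ∧ Module.Projective A M

lemma IsFGProj.of_retract {M N : ModuleCat.{u} A} (hN : IsFGProj N)
    (i : M ⟶ N) (r : N ⟶ M) (h : i ≫ r = 𝟙 M) : IsFGProj M := by
  have h' : r.hom ∘ₗ i.hom = LinearMap.id := by
    rw [← ModuleCat.hom_comp, h, ModuleCat.hom_id]
  obtain ⟨h1, h2⟩ := hN
  refine ⟨Module.Finite.of_surjective r.hom fun x => ⟨i.hom x, ?_⟩,
    Module.Projective.of_split i.hom r.hom h'⟩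
  exact LinearMap.congr_fun h' x

lemma IsFGProj.of_iso {M N : ModuleCat.{u} A} (hN : IsFGProj N) (e : M ≅ N) : IsFGProj M :=
  hN.of_retract e.hom e.inv e.hom_inv_id

lemma IsFGProj.of_isZero {M : ModuleCat.{u} A} (hM : IsZero M) : IsFGProj M := by
  have := ModuleCat.subsingleton_of_isZero hM
  have := Module.Free.of_subsingleton A M
  exact ⟨inferInstance, Module.Projective.of_free⟩

lemma IsFGProj.biprod {M N : ModuleCat.{u} A} (hM : IsFGProj M) (hN : IsFGProj N) :
    IsFGProj (M ⊞ N) := by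
  obtain ⟨h1, h2⟩ := hM
  obtain ⟨h3, h4⟩ := hN
  refine IsFGProj.of_iso (N := ModuleCat.of A (M × N)) ?_ (ModuleCat.biprodIsoProd M N)
  exact ⟨inferInstanceAs (Module.Finite A (M × N)), inferInstanceAs (Module.Projective A (M × N))⟩

lemma IsFGProj.self : IsFGProj (ModuleCat.of A A) :=
  ⟨inferInstanceAs (Module.Finite A A), inferInstanceAs (Module.Projective A A)⟩

/-- There is an exact sequence `0 → Pₙ → ⋯ → P₁ → P₀ → M → 0` with all `Pᵢ` finitely generated
projective. -/
def ModulePdLE (M : ModuleCat.{u} A) (n : ℕ) : Prop :=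
  ∃ (P : ℕ → ModuleCat.{u} A) (d : ∀ i, P (i + 1) ⟶ P i) (ε : P 0 ⟶ M),
    (∀ i, IsFGProj (P i)) ∧ (∀ i, n < i → IsZero (P i)) ∧
    Function.Surjective ε.hom ∧ Function.Exact (d 0).hom ε.hom ∧
    ∀ i, Function.Exact (d (i + 1)).hom (d i).hom

/-- Projective dimension of a module, with value `⊤` if there is no finite resolution
(and `0` for the zero module). -/
def modulePd (M : ModuleCat.{u} A) : ℕ∞ :=
  sInf {m : ℕ∞ | ∃ n : ℕ, m = n ∧ ModulePdLE M n}

end Modules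

section Dual

variable (A B D : Type u) [Ring A] [Ring B] [AddCommGroup D] [Module A D] [Module B D]
  [SMulCommClass A B D]

/-- The `B`-module `Hom_A(M, D)`. -/
def dualObj (M : ModuleCat.{u} A) : ModuleCat.{u} B :=
  ModuleCat.of B (M →ₗ[A] D)

/-- Precomposition with `f`, as a map `Hom_A(N, D) → Hom_A(M, D)`. -/
def dualMap {M N : ModuleCat.{u} A} (f : M ⟶ N) : dualObj A B D N ⟶ dualObj A B D M :=
  ModuleCat.ofHom (X := N →ₗ[A] D) (Y := M →ₗ[A] D)
    { toFun := fun g => g ∘ₗ f.hom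
      map_add' := fun _ _ => rfl
      map_smul' := fun _ _ => rfl }

lemma dualMap_zero (M N : ModuleCat.{u} A) : dualMap A B D (0 : M ⟶ N) = 0 := by
  ext g
  exact LinearMap.comp_zero (g : N →ₗ[A] D)

lemma dualMap_comp {L M N : ModuleCat.{u} A} (f : L ⟶ M) (g : M ⟶ N) :
    dualMap A B D g ≫ dualMap A B D f = dualMap A B D (f ≫ g) := rfl

lemma IsFGProj.dualObj [Module.Finite B D] [Module.Projective B D]
    {M : ModuleCat.{u} A} (hM : IsFGProj M) : IsFGProj (dualObj A B D M) := by
  obtain ⟨h1, h2⟩ := hM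
  obtain ⟨n, f, hf⟩ := Module.Finite.exists_fin' A M
  obtain ⟨s, hs⟩ := Module.projective_lifting_property f LinearMap.id hf
  let i : (M →ₗ[A] D) →ₗ[B] (Fin n → D) :=
    { toFun := fun g k => g (f (Pi.single k 1))
      map_add' := fun _ _ => rfl
      map_smul' := fun _ _ => rfl }
  let r : (Fin n → D) →ₗ[B] (M →ₗ[A] D) :=
    { toFun := fun v =>
        { toFun := fun m => ∑ k, s m k • v k
          map_add' := fun x y => by simp [add_smul, Finset.sum_add_distrib]
          map_smul' := fun a x => by simp [Finset.smul_sum, mul_smul] }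
      map_add' := fun v w => by
        ext m; simp [Finset.sum_add_distrib]
      map_smul' := fun b v => by
        ext m; simp [Finset.smul_sum, smul_comm] }
  have hri : r ∘ₗ i = LinearMap.id := by
    ext g m
    have h3 : f (s m) = m := LinearMap.congr_fun hs m
    have h4 : s m = ∑ k, s m k • (Pi.single k 1 : Fin n → A) := by
      ext j; simp [Finset.sum_apply, Pi.single_apply]
    change ∑ k, s m k • g (f (Pi.single k 1)) = g m
    conv_rhs => rw [← h3, h4]
    simp [map_sum]
  exact IsFGProj.of_retract (N := ModuleCat.of B (Fin n → D))
    ⟨inferInstanceAs (Module.Finite B (Fin n → D)),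
      Module.Projective.of_equiv (DirectSum.linearEquivFunOnFintype B (Fin n) (fun _ => D))⟩
    (ModuleCat.ofHom i) (ModuleCat.ofHom r) (by ext1; exact hri)

/-- `T` is an Auslander transpose of `M`: the cokernel of the dual of `d₁` for some
finite projective presentation `P₁ → P₀ → M → 0` with first map `d₁`. -/
def IsTranspose (M : ModuleCat.{u} A) (T : ModuleCat.{u} B) : Prop :=
  ∃ (P₁ P₀ : ModuleCat.{u} A) (d₁ : P₁ ⟶ P₀) (d₀ : P₀ ⟶ M),
    IsFGProj P₁ ∧ IsFGProj P₀ ∧ Function.Surjective d₀.hom ∧ Function.Exact d₁.hom d₀.hom ∧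
    Nonempty (T ≅ cokernel (dualMap A B D d₁))

/-- `M` is a Gorenstein projective module: it is finitely generated, `Extⁿ_A(M, D) = 0` and
`Extⁿ_B(Tr M, D) = 0` for all `n > 0`.  (Here `D` is the ring itself; the transpose is unique
up to projective summands, so that its choice does not matter.) -/
def IsGorensteinProjectiveModule (M : ModuleCat.{u} A) : Prop :=
  Module.Finite A M ∧
  (∀ n : ℕ, 0 < n → Subsingleton (Abelian.Ext M (ModuleCat.of A D) n)) ∧
  ∃ T : ModuleCat.{u} B, IsTranspose A B D M T ∧
    ∀ n : ℕ, 0 < n → Subsingleton (Abelian.Ext T (ModuleCat.of B D) n)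

/-- The dual complex, with `Hom_A(X⁻ⁱ, D)` in degree `i`. -/
def dualComplex (X : CochainComplex (ModuleCat.{u} A) ℤ) :
    CochainComplex (ModuleCat.{u} B) ℤ where
  X i := dualObj A B D (X.X (-i))
  d i j := dualMap A B D (X.d (-j) (-i))
  shape i j hij := by
    rw [X.shape, dualMap_zero]
    intro h
    apply hij
    simp only [ComplexShape.up_Rel] at h ⊢
    lia
  d_comp_d' i j k _ _ := by
    rw [dualMap_comp, X.d_comp_d, dualMap_zero]

end Dual

section HomotopyCat

variable (A : Type u) [Ring A]

/-- The objects of the homotopy category of complexes of modules that are complexes of finitely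
generated projective modules. -/
def projComplexes : ObjectProperty (HomotopyCategory (ModuleCat.{u} A) (ComplexShape.up ℤ)) :=
  fun X => ∀ i : ℤ, IsFGProj (X.as.X i)

instance : (projComplexes A).ContainsZero where
  exists_zero :=
    ⟨(HomotopyCategory.quotient _ _).obj 0, Functor.map_isZero _ (isZero_zero _), fun i =>
      IsFGProj.of_isZero (Functor.map_isZero
        (HomologicalComplex.eval (ModuleCat.{u} A) (ComplexShape.up ℤ) i) (isZero_zero _))⟩

instance : (projComplexes A).IsStableUnderShift ℤ where
  isStableUnderShiftBy n :=
    { le_shift := fun X hX => by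
        obtain ⟨K : CochainComplex _ _, rfl⟩ := X.quotient_obj_surjective
        rw [ObjectProperty.prop_shift_iff, HomotopyCategory.shift_quotient_obj]
        exact fun i => hX (i + n) }

instance : (projComplexes A).IsTriangulatedClosed₃ where
  ext₃' T hT h₁ h₂ := by
    obtain ⟨f : T.obj₁.as ⟶ T.obj₂.as, hf⟩ :=
      (HomotopyCategory.quotient _ _).map_surjective T.mor₁
    refine ⟨(HomotopyCategory.quotient _ _).obj (CochainComplex.mappingCone f), ?_,
      ⟨Triangle.π₃.mapIso (isoTriangleOfIso₁₂ T _ hT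
        (HomotopyCategory.mappingCone_triangleh_distinguished f)
        (Iso.refl _) (Iso.refl _) ?_)⟩⟩
    · intro i
      exact IsFGProj.of_iso ((h₁ (i + 1)).biprod (h₂ i))
        (HomologicalComplex.homotopyCofiber.XIsoBiprod f i (i + 1) (by simp))
    · refine (Category.comp_id _).trans (Eq.trans ?_ (Category.id_comp _).symm)
      exact hf.symm

instance : (projComplexes A).IsTriangulated where
  toIsTriangulatedClosed₂ := .of_isTriangulatedClosed₃

/-- The homotopy category `K(proj A)` of complexes of finitely generated projective modules,
a triangulated category. -/
abbrev KProj := (projComplexes A).FullSubcategory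

variable {A}

/-- The underlying complex of an object of `K(proj A)`. -/
abbrev cpx (X : KProj A) : CochainComplex (ModuleCat.{u} A) ℤ := X.obj.as

/-- `Cⁱ(X)`, the cokernel of the differential `Xⁱ⁻¹ → Xⁱ`. -/
def cok (X : KProj A) (i : ℤ) : ModuleCat.{u} A :=
  cokernel ((cpx X).d (i - 1) i)

/-- The functor `Hⁱ` on `K(proj A)`. -/
abbrev cohomology (A : Type u) [Ring A] (i : ℤ) : KProj A ⥤ ModuleCat.{u} A :=
  (projComplexes A).ι ⋙ HomotopyCategory.homologyFunctor (ModuleCat.{u} A) (ComplexShape.up ℤ) i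

/-- Cohomologically surjective morphisms. -/
def CohSurjective {X Y : KProj A} (f : X ⟶ Y) : Prop :=
  ∀ i : ℤ, Function.Surjective ((cohomology A i).map f).hom

/-- `0 → Hⁱ(X) → Hⁱ(Y) → Hⁱ(Z) → 0` is exact for every `i`. -/
def CohShortExact {X Y Z : KProj A} (f : X ⟶ Y) (g : Y ⟶ Z) : Prop :=
  ∀ i : ℤ, Function.Injective ((cohomology A i).map f).hom ∧
    Function.Exact ((cohomology A i).map f).hom ((cohomology A i).map g).hom ∧
    Function.Surjective ((cohomology A i).map g).hom

/-- A cohomologically ghost triangle `X → Y → Z → X[1]` in `K(proj A)`. -/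
def IsCohGhostTriangle {X Y Z : KProj A} (f : X ⟶ Y) (g : Y ⟶ Z) (h : Z ⟶ X⟦(1 : ℤ)⟧) : Prop :=
  Triangle.mk f g h ∈ distTriang (KProj A) ∧ CohShortExact f g

/-- Split complexes: there are `sⁱ⁺¹ : Xⁱ⁺¹ → Xⁱ` with `d s d = d`. -/
def IsSplitComplex (X : KProj A) : Prop :=
  ∃ s : ∀ i : ℤ, (cpx X).X (i + 1) ⟶ (cpx X).X i,
    ∀ i : ℤ, (cpx X).d i (i + 1) ≫ s i ≫ (cpx X).d i (i + 1) = (cpx X).d i (i + 1)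

variable (A) in
/-- The regular module, viewed as a complex concentrated in degree `0`. -/
def unitComplex : KProj A where
  obj := (HomotopyCategory.quotient _ _).obj
    ((HomologicalComplex.single (ModuleCat.{u} A) (ComplexShape.up ℤ) 0).obj (ModuleCat.of A A))
  property i := by
    by_cases hi : i = 0
    · subst hi
      exact IsFGProj.of_iso IsFGProj.self
        (HomologicalComplex.singleObjXSelf (ComplexShape.up ℤ) 0 (ModuleCat.of A A))
    · exact IsFGProj.of_isZero
        (HomologicalComplex.isZero_single_obj_X (ComplexShape.up ℤ) 0 (ModuleCat.of A A) i hi)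

/-- The full subcategory `Add A` of `K(proj A)`: the intersection of all full subcategories that
contain the regular module in degree `0` and are closed under shifts, direct summands and those
coproducts that exist in `K(proj A)`.  (In a triangulated category the direct summands of an
object are its retracts.) -/
def IsAdd (X : KProj A) : Prop :=
  ∀ Q : ObjectProperty (KProj A),
    Q (unitComplex A) →
    (∀ (Y : KProj A) (n : ℤ), Q Y → Q (Y⟦n⟧)) →
    (∀ Y Z : KProj A, Nonempty (Retract Y Z) → Q Z → Q Y) →
    (∀ (J : Type u) (F : J → KProj A) (c : Cofan F), Nonempty (IsColimit c) →
      (∀ j, Q (F j)) → Q c.pt) →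
    Q X

/-- `p : P ⟶ X` is a right `Add A`-approximation of `X`. -/
def IsRightAddApprox {P X : KProj A} (p : P ⟶ X) : Prop :=
  IsAdd P ∧ ∀ W : KProj A, IsAdd W → ∀ w : W ⟶ X, ∃ t : W ⟶ P, t ≫ p = w

/-- `q : X ⟶ Q` is a left `Add A`-approximation of `X`. -/
def IsLeftAddApprox {X Q : KProj A} (q : X ⟶ Q) : Prop :=
  IsAdd Q ∧ ∀ W : KProj A, IsAdd W → ∀ w : X ⟶ W, ∃ t : Q ⟶ W, q ≫ t = w

/-- `W` is a syzygy `ΩX`: it is isomorphic in `K(proj A)` to `Cone(p)[-1]` for a right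
`Add A`-approximation `p` of `X`, that is, it completes `p` to a triangle
`W → P → X → W[1]`. -/
def IsSyzygy (X W : KProj A) : Prop :=
  ∃ (P : KProj A) (p : P ⟶ X), IsRightAddApprox p ∧
    ∃ (a : W ⟶ P) (h : X ⟶ W⟦(1 : ℤ)⟧), Triangle.mk a p h ∈ distTriang (KProj A)

/-- `W` is a cosyzygy `Ω⁻X`: it is isomorphic in `K(proj A)` to `Cone(q)` for a left
`Add A`-approximation `q` of `X`, that is, it completes `q` to a triangle
`X → Q → W → X[1]`. -/
def IsCosyzygy (X W : KProj A) : Prop :=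
  ∃ (Q : KProj A) (q : X ⟶ Q), IsLeftAddApprox q ∧
    ∃ (b : Q ⟶ W) (h : W ⟶ X⟦(1 : ℤ)⟧), Triangle.mk q b h ∈ distTriang (KProj A)

/-- There are triangles `Xᵢ₊₁ → Pᵢ → Xᵢ → Xᵢ₊₁[1]`, for `0 ≤ i ≤ n - 1`, with `Pᵢ` split and
`Pᵢ → Xᵢ` cohomologically surjective, such that `X₀ ≅ X` and `Xₙ` is split. -/
def ComplexPdLE (X : KProj A) (n : ℕ) : Prop :=
  ∃ Y P : ℕ → KProj A, Nonempty (Y 0 ≅ X) ∧ IsSplitComplex (Y n) ∧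
    ∀ i < n, IsSplitComplex (P i) ∧
      ∃ (a : Y (i + 1) ⟶ P i) (f : P i ⟶ Y i) (h : Y i ⟶ (Y (i + 1))⟦(1 : ℤ)⟧),
        Triangle.mk a f h ∈ distTriang (KProj A) ∧ CohSurjective f

/-- Projective dimension of an object of `K(proj A)`. -/
def complexPd (X : KProj A) : ℕ∞ :=
  sInf {m : ℕ∞ | ∃ n : ℕ, m = n ∧ ComplexPdLE X n}

end HomotopyCat

section DualHomotopyCat

variable (A B D : Type u) [Ring A] [Ring B] [AddCommGroup D] [Module A D] [Module B D]
  [SMulCommClass A B D]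

/-- The dual `X*` of an object of `K(proj A)`, as an object of `K(proj B)`. -/
def dual [Module.Finite B D] [Module.Projective B D] (X : KProj A) : KProj B where
  obj := (HomotopyCategory.quotient _ _).obj (dualComplex A B D (cpx X))
  property i := IsFGProj.dualObj A B D (X.property (-i))

/-- Gorenstein projective complexes: every `Cⁱ(X)` is a Gorenstein projective module. -/
def IsGorensteinProjective (X : KProj A) : Prop :=
  ∀ i : ℤ, IsGorensteinProjectiveModule A B D (cok X i)

end DualHomotopyCat

/-- The ring `R` as a right module over itself is isomorphic to the regular `Rᵐᵒᵖ`-module. -/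
def selfEquivOp (R : Type u) [Ring R] : Rᵐᵒᵖ ≃ₗ[Rᵐᵒᵖ] R where
  toFun a := a.unop
  invFun r := MulOpposite.op r
  map_add' _ _ := rfl
  map_smul' _ _ := rfl
  left_inv _ := rfl
  right_inv _ := rfl

instance finite_op_self (R : Type u) [Ring R] : Module.Finite Rᵐᵒᵖ R :=
  Module.Finite.equiv (selfEquivOp R)

instance projective_op_self (R : Type u) [Ring R] : Module.Projective Rᵐᵒᵖ R :=
  Module.Projective.of_equiv (selfEquivOp R)

end StableComplex

end

open StableComplex

/-! Everything is read off the cokernels `Cⁱ(X)`. A homotopy equivalence changes them only up to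
retracts and finitely generated projective summands, so a module property stable under these
operations (`IsStableProperty`) may be tested on `Cⁱ` of any complex isomorphic to `X` in the
homotopy category. Projective dimension at most `n` and Gorenstein projectivity are such properties.

Modules: by Auslander's sequence `0 → Ext¹(Tr M, D) → M → M** → Ext²(Tr M, D) → 0` and dimension
shifting, Gorenstein projective means totally reflexive: finitely generated, reflexive, with
`Extⁿ(M, D) = 0 = Extⁿ(M*, D)` for `n > 0` (`isGorensteinProjectiveModule_iff`). In this form
two-out-of-three along short exact sequences is a diagram chase, and the symmetry between a module
and its transpose is visible.

Triangles: if `X → Y → Z` is a triangle with `g : Y → Z` surjective on cohomology, then `0 → Cⁱ(cone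
g) → Cⁱ⁺¹(Y) ⊞ Zⁱ⁺¹ → Cⁱ⁺¹(Z) → 0` is exact (`cokCone_shortExact`), and `cone g ≅ X[1]`. With `Y`
split this is a dimension shift and gives (1), since a complex is split exactly when all its `Cⁱ`
are projective. Two-out-of-three gives (3-e), and also the syzygies in (3-d): right approximations
are surjective on cohomology because `Add R` contains the stalk complexes, and objects of `Add R`
have projective `Cⁱ` because they are retracts of complexes with zero differential.

Cosyzygies: `Cⁱ(X) → Cⁱ(Q) ⊞ Xⁱ⁺¹ → Cⁱ(cone q) → 0` is always exact. The approximation property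
makes every functional on `Cⁱ(X)` extend along the first map, and reflexivity then forces that map
to be injective. Duals: `Cⁱ(X*)` is a transpose of `C¹⁻ⁱ(X)`. Cohomology (2): `Hⁱ(X)` is the kernel
of `Cⁱ(X) → Xⁱ⁺¹`, whose image is the kernel of `Xⁱ⁺¹ → Cⁱ⁺¹(X)`. -/

noncomputable section

namespace StableComplex

open scoped ZeroObject

/-! ### Vanishing of Ext along short exact sequences -/

section ExtVanishing

open Abelian

variable {A : Type u} [Ring A] {D : ModuleCat.{u} A}

/-- All higher extension groups `Extⁿ(M, D)`, `n > 0`, vanish. -/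
def ExtVanish (D M : ModuleCat.{u} A) : Prop :=
  ∀ n : ℕ, 0 < n → Subsingleton (Ext M D n)

lemma ExtVanish.of_projective (M : ModuleCat.{u} A) [Projective M] : ExtVanish D M := by
  intro n hn
  obtain ⟨n, rfl⟩ := Nat.exists_eq_succ_of_ne_zero hn.ne'
  exact subsingleton_of_forall_eq 0 fun e => e.eq_zero_of_projective

lemma ext_subsingleton_of_retract {M N : ModuleCat.{u} A} (r : Retract M N) (n : ℕ)
    (h : Subsingleton (Ext N D n)) : Subsingleton (Ext M D n) := by
  refine subsingleton_of_forall_eq 0 fun e => ?_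
  have h1 : e = (Ext.mk₀ (r.i ≫ r.r)).comp e (zero_add n) := by simp
  rw [h1, ← Ext.mk₀_comp_mk₀, Ext.comp_assoc (γ := e) _ _ (zero_add 0) (zero_add n) (by simp),
    Subsingleton.elim ((Ext.mk₀ r.r).comp e (zero_add n)) 0, Ext.comp_zero]

lemma ExtVanish.of_retract {M N : ModuleCat.{u} A} (r : Retract M N) (h : ExtVanish D N) :
    ExtVanish D M :=
  fun n hn => ext_subsingleton_of_retract r n (h n hn)

variable {S : ShortComplex (ModuleCat.{u} A)} (hS : S.ShortExact)

include hS

lemma ExtVanish.middle (h₁ : ExtVanish D S.X₁) (h₃ : ExtVanish D S.X₃) : ExtVanish D S.X₂ := by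
  intro n hn
  refine subsingleton_of_forall_eq 0 fun e => ?_
  obtain ⟨e', rfl⟩ := Ext.contravariant_sequence_exact₂ hS D e
    ((h₁ n hn).elim _ _)
  rw [(h₃ n hn).elim e' 0, Ext.comp_zero]

lemma ext_subsingleton_left (n : ℕ) (h₂ : Subsingleton (Ext S.X₂ D n))
    (h₃ : Subsingleton (Ext S.X₃ D (n + 1))) : Subsingleton (Ext S.X₁ D n) := by
  refine subsingleton_of_forall_eq 0 fun e => ?_
  obtain ⟨e', rfl⟩ := Ext.contravariant_sequence_exact₁ hS D e (add_comm 1 n)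
    (h₃.elim _ _)
  rw [h₂.elim e' 0, Ext.comp_zero]

lemma ext_subsingleton_right (n : ℕ) (h₁ : Subsingleton (Ext S.X₁ D n))
    (h₂ : Subsingleton (Ext S.X₂ D (n + 1))) : Subsingleton (Ext S.X₃ D (n + 1)) := by
  refine subsingleton_of_forall_eq 0 fun e => ?_
  obtain ⟨e', rfl⟩ := Ext.contravariant_sequence_exact₃ hS D e
    (h₂.elim _ _) (add_comm 1 n)
  rw [h₁.elim e' 0, Ext.comp_zero]

lemma ExtVanish.left (h₂ : ExtVanish D S.X₂) (h₃ : ExtVanish D S.X₃) : ExtVanish D S.X₁ :=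
  fun n hn => ext_subsingleton_left hS n (h₂ n hn) (h₃ (n + 1) n.succ_pos)

lemma exists_extension_of_ext_one (h : Subsingleton (Ext S.X₃ D 1)) (φ : S.X₁ ⟶ D) :
    ∃ ψ : S.X₂ ⟶ D, S.f ≫ ψ = φ := by
  obtain ⟨e, he⟩ := Ext.contravariant_sequence_exact₁ hS D (Ext.mk₀ φ) (add_zero 1)
    (h.elim _ _)
  obtain ⟨ψ, rfl⟩ := Ext.mk₀_bijective _ _ |>.2 e
  rw [Ext.mk₀_comp_mk₀] at he
  exact ⟨ψ, (Ext.mk₀_bijective _ _).1 he⟩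

/-- The connecting map `Hom(X₁, D) → Ext¹(X₃, D)` is onto once `Ext¹(X₂, D) = 0`, and it kills every
functional that extends to `X₂`. -/
lemma ext_one_subsingleton_of_extension (h₂ : Subsingleton (Ext S.X₂ D 1))
    (h : ∀ φ : S.X₁ ⟶ D, ∃ ψ : S.X₂ ⟶ D, S.f ≫ ψ = φ) : Subsingleton (Ext S.X₃ D 1) := by
  refine subsingleton_of_forall_eq 0 fun e => ?_
  obtain ⟨e', rfl⟩ := Ext.contravariant_sequence_exact₃ hS D e
    (h₂.elim _ _) (add_zero 1)
  obtain ⟨φ, rfl⟩ := Ext.mk₀_bijective _ _ |>.2 e'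
  obtain ⟨ψ, rfl⟩ := h φ
  rw [← Ext.mk₀_comp_mk₀, ← Ext.comp_assoc (α := hS.extClass) _ _ (add_zero 1) (add_zero 0)
    (by simp), hS.extClass_comp, Ext.zero_comp]

lemma ExtVanish.right (h₁ : ExtVanish D S.X₁) (h₂ : ExtVanish D S.X₂)
    (h : ∀ φ : S.X₁ ⟶ D, ∃ ψ : S.X₂ ⟶ D, S.f ≫ ψ = φ) : ExtVanish D S.X₃ := by
  intro n hn
  obtain ⟨n, rfl⟩ := Nat.exists_eq_succ_of_ne_zero hn.ne'
  obtain rfl | hn := Nat.eq_zero_or_pos n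
  · exact ext_one_subsingleton_of_extension hS (h₂ 1 one_pos) h
  · exact ext_subsingleton_right hS n (h₁ n hn) (h₂ (n + 1) n.succ_pos)

end ExtVanishing

section ShortExact

variable {A : Type u} [Ring A]

lemma shortExact_of_maps {S : ShortComplex (ModuleCat.{u} A)}
    (hf : Function.Injective S.f.hom) (hfg : Function.Exact S.f.hom S.g.hom)
    (hg : Function.Surjective S.g.hom) : S.ShortExact where
  exact := (ShortComplex.ShortExact.moduleCat_exact_iff_function_exact S).2 hfg
  mono_f := (ModuleCat.mono_iff_injective _).2 hf
  epi_g := (ModuleCat.epi_iff_surjective _).2 hg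

end ShortExact

/-! ### Totally reflexive modules and two-out-of-three -/

section TotallyReflexive

variable (A B D : Type u) [Ring A] [Ring B] [AddCommGroup D] [Module A D] [Module B D]
  [SMulCommClass A B D]

/-- The evaluation map from `M` to the `B`-linear functionals on `Hom_A(M, D)`. -/
def evalFun (M : ModuleCat.{u} A) (m : M) : dualObj A B D M →ₗ[B] D where
  toFun α := (show M →ₗ[A] D from α) m
  map_add' _ _ := rfl
  map_smul' _ _ := rfl

lemma evalFun_apply (M : ModuleCat.{u} A) (m : M) (α : M →ₗ[A] D) :
    evalFun A B D M m α = α m := rfl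

/-- Totally reflexive modules: finitely generated `M` with `Extⁿ(M, D) = 0 = Extⁿ(M*, D)` for
`n > 0` such that the evaluation `M → M**` is bijective. -/
structure TotallyReflexive (M : ModuleCat.{u} A) : Prop where
  finite : Module.Finite A M
  ext : ExtVanish (ModuleCat.of A D) M
  extDual : ExtVanish (ModuleCat.of B D) (dualObj A B D M)
  bijective : Function.Bijective (evalFun A B D M)

variable {A}

/-- Every map from the left term of `S` to `D` extends to the middle term. -/
def DualSurjective (S : ShortComplex (ModuleCat.{u} A)) : Prop :=
  ∀ φ : S.X₁ →ₗ[A] D, ∃ ψ : S.X₂ →ₗ[A] D, ψ ∘ₗ S.f.hom = φ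

/-- The dual of a short complex. -/
def dualShortComplex (S : ShortComplex (ModuleCat.{u} A)) : ShortComplex (ModuleCat.{u} B) :=
  ShortComplex.mk (dualMap A B D S.g) (dualMap A B D S.f)
    (by rw [dualMap_comp, S.zero, dualMap_zero])

variable {D}

lemma dualSurjective_of_ext {S : ShortComplex (ModuleCat.{u} A)} (hS : S.ShortExact)
    (h : ExtVanish (ModuleCat.of A D) S.X₃) : DualSurjective D S := fun φ => by
  obtain ⟨ψ, hψ⟩ := exists_extension_of_ext_one hS (h 1 one_pos) (ModuleCat.ofHom φ)
  exact ⟨ψ.hom, congrArg ModuleCat.Hom.hom hψ⟩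

lemma dualMap_exact {L M N : ModuleCat.{u} A} (f : L ⟶ M) (g : M ⟶ N)
    (hfg : Function.Exact f.hom g.hom) (hg : Function.Surjective g.hom) :
    Function.Exact (dualMap A B D g).hom (dualMap A B D f).hom := by
  intro (α : M →ₗ[A] D)
  constructor
  · intro (hα : α ∘ₗ f.hom = 0)
    let S := ShortComplex.mk f g (by ext x; exact hfg.apply_apply_eq_zero x)
    have hS : S.Exact := (ShortComplex.ShortExact.moduleCat_exact_iff_function_exact S).2 hfg
    have : Epi S.g := (ModuleCat.epi_iff_surjective _).2 hg
    let β := hS.desc (ModuleCat.ofHom α) (by ext1; exact hα)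
    refine ⟨(show N →ₗ[A] D from β.hom), ?_⟩
    exact congrArg ModuleCat.Hom.hom (hS.g_desc (ModuleCat.ofHom α) _)
  · rintro ⟨(β : N →ₗ[A] D), rfl⟩
    change (β ∘ₗ g.hom) ∘ₗ f.hom = 0
    ext x
    simp [hfg.apply_apply_eq_zero x]

lemma dualMap_injective {M N : ModuleCat.{u} A} (g : M ⟶ N)
    (hg : Function.Surjective g.hom) : Function.Injective (dualMap A B D g).hom := by
  intro (α : N →ₗ[A] D) (β : N →ₗ[A] D) (h : α ∘ₗ g.hom = β ∘ₗ g.hom)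
  exact (LinearMap.cancel_right hg).1 h

lemma dualShortComplex_shortExact {S : ShortComplex (ModuleCat.{u} A)} (hS : S.ShortExact)
    (h : DualSurjective D S) : (dualShortComplex B D S).ShortExact := by
  have hg := hS.moduleCat_surjective_g
  have hfg := (ShortComplex.ShortExact.moduleCat_exact_iff_function_exact S).1 hS.exact
  exact shortExact_of_maps (dualMap_injective B S.g hg) (dualMap_exact B S.f S.g hfg hg) h

section TwoOutOfThree

variable {B} {S : ShortComplex (ModuleCat.{u} A)} (hS : S.ShortExact)

include hS

/-- Since `Ext¹(X₃, D) = 0`, the dual sequence `0 → X₃* → X₂* → X₁* → 0` is exact. It yields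
`Extⁿ(X₁*, D) = 0` provided functionals on `X₃*` extend to `X₂*`. They do: each is evaluation at
some `z` in `X₃`, and evaluation at a lift of `z` to `X₂` extends it. -/
lemma TotallyReflexive.left (hfin : Module.Finite A S.X₁) (h₂ : TotallyReflexive A B D S.X₂)
    (h₃ : TotallyReflexive A B D S.X₃) : TotallyReflexive A B D S.X₁ := by
  have hf := hS.moduleCat_injective_f
  have hg := hS.moduleCat_surjective_g
  have hfg := (ShortComplex.ShortExact.moduleCat_exact_iff_function_exact S).1 hS.exact
  have hD := dualSurjective_of_ext hS h₃.ext
  refine ⟨hfin, h₂.ext.left hS h₃.ext, ?_, ?_, ?_⟩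
  · refine ExtVanish.right (dualShortComplex_shortExact B hS hD) h₃.extDual h₂.extDual ?_
    intro φ
    obtain ⟨z, hz⟩ := h₃.bijective.2 φ.hom
    obtain ⟨y, rfl⟩ := hg z
    refine ⟨ModuleCat.ofHom (evalFun A B D S.X₂ y), ?_⟩
    ext1
    rw [← hz]
    rfl
  · intro x x' hx
    apply hf
    apply h₂.bijective.1
    ext (α : S.X₂ →ₗ[A] D)
    exact LinearMap.congr_fun hx (α ∘ₗ S.f.hom)
  · intro θ
    obtain ⟨y, hy⟩ := h₂.bijective.2 (θ ∘ₗ (dualMap A B D S.f).hom)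
    have hy' (α : S.X₂ →ₗ[A] D) : α y = θ (α ∘ₗ S.f.hom) := LinearMap.congr_fun hy α
    obtain ⟨x, rfl⟩ := (hfg y).1 (h₃.bijective.1 (by
      ext (β : S.X₃ →ₗ[A] D)
      rw [evalFun_apply, evalFun_apply, map_zero]
      refine (hy' (β ∘ₗ S.g.hom)).trans ?_
      have : (β ∘ₗ S.g.hom) ∘ₗ S.f.hom = 0 := by ext x; simp [hfg.apply_apply_eq_zero x]
      rw [this]
      exact map_zero θ))
    refine ⟨x, ?_⟩
    ext (α : S.X₁ →ₗ[A] D)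
    obtain ⟨μ, rfl⟩ := hD α
    exact hy' μ

/-- The evaluation map of `X₂` is compared with those of `X₁` and `X₃` as in the five lemma; the
dual sequence is exact because `Ext¹(X₃, D) = 0`. -/
lemma TotallyReflexive.middle (h₁ : TotallyReflexive A B D S.X₁)
    (h₃ : TotallyReflexive A B D S.X₃) : TotallyReflexive A B D S.X₂ := by
  have hg := hS.moduleCat_surjective_g
  have hfg := (ShortComplex.ShortExact.moduleCat_exact_iff_function_exact S).1 hS.exact
  have hD := dualSurjective_of_ext hS h₃.ext
  have hS' := dualShortComplex_shortExact B hS hD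
  have := h₁.finite
  have := h₃.finite
  refine ⟨Module.Finite.of_exact hfg hg,
    h₁.ext.middle hS h₃.ext, ExtVanish.middle hS' h₃.extDual h₁.extDual, ?_, ?_⟩
  · refine (injective_iff_map_eq_zero' (AddMonoidHom.mk' (evalFun A B D S.X₂) ?_)).2 ?_
    · intro a b
      ext (α : S.X₂ →ₗ[A] D)
      exact α.map_add a b
    intro y
    refine ⟨fun hy => ?_, fun hy => by rw [hy, map_zero]⟩
    have hy' (α : S.X₂ →ₗ[A] D) : α y = 0 := LinearMap.congr_fun hy α
    obtain ⟨x, rfl⟩ := (hfg y).1 (h₃.bijective.1 (by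
      ext (β : S.X₃ →ₗ[A] D)
      rw [evalFun_apply, evalFun_apply, map_zero]
      exact hy' (β ∘ₗ S.g.hom)))
    have : x = 0 := h₁.bijective.1 (by
      ext (α : S.X₁ →ₗ[A] D)
      obtain ⟨μ, rfl⟩ := hD α
      rw [evalFun_apply, evalFun_apply, map_zero]
      exact hy' μ)
    rw [this, map_zero]
  · intro θ
    obtain ⟨z, hz⟩ := h₃.bijective.2 (θ ∘ₗ (dualMap A B D S.g).hom)
    obtain ⟨y, rfl⟩ := hg z
    have hz' (β : S.X₃ →ₗ[A] D) : β (S.g.hom y) = θ (β ∘ₗ S.g.hom) := LinearMap.congr_fun hz β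
    have := hS'.epi_g
    -- After subtracting evaluation at `y`, the functional vanishes on `X₃*` and therefore descends
    -- to `X₁*`.
    let θ' : dualObj A B D S.X₁ ⟶ ModuleCat.of B D :=
      hS'.exact.desc (ModuleCat.ofHom (θ - evalFun A B D S.X₂ y)) (by
        ext (β : S.X₃ →ₗ[A] D)
        change θ (β ∘ₗ S.g.hom) - β (S.g.hom y) = 0
        rw [hz', sub_self])
    have hθ' (μ : S.X₂ →ₗ[A] D) : θ'.hom (μ ∘ₗ S.f.hom) = θ μ - μ y :=
      LinearMap.congr_fun (congrArg ModuleCat.Hom.hom (hS'.exact.g_desc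
        (ModuleCat.ofHom (θ - evalFun A B D S.X₂ y)) _)) μ
    obtain ⟨x, hx⟩ := h₁.bijective.2 θ'.hom
    refine ⟨y + S.f.hom x, ?_⟩
    ext (μ : S.X₂ →ₗ[A] D)
    have h1 : μ (S.f.hom x) = θ μ - μ y := by
      rw [← hθ', ← hx]
      rfl
    rw [evalFun_apply, map_add, h1]
    abel

/-- Cokernels need the extension hypothesis `hD`, as `0 → ℤ → ℤ → ℤ/2 → 0` shows. It gives both
`Ext¹(X₃, D) = 0` and exactness of the dual sequence. Functionals on `X₃*` extend to `X₂*` because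
`Ext¹(X₁*, D) = 0`. -/
lemma TotallyReflexive.right (h₁ : TotallyReflexive A B D S.X₁)
    (h₂ : TotallyReflexive A B D S.X₂) (hD : DualSurjective D S) :
    TotallyReflexive A B D S.X₃ := by
  have hg := hS.moduleCat_surjective_g
  have hfg := (ShortComplex.ShortExact.moduleCat_exact_iff_function_exact S).1 hS.exact
  have hS' := dualShortComplex_shortExact B hS hD
  have := h₂.finite
  refine ⟨Module.Finite.of_surjective S.g.hom hg,
    h₁.ext.right hS h₂.ext ?_, ExtVanish.left hS' h₂.extDual h₁.extDual, ?_, ?_⟩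
  · intro φ
    obtain ⟨ψ, hψ⟩ := hD φ.hom
    exact ⟨ModuleCat.ofHom ψ, by ext1; exact hψ⟩
  · refine (injective_iff_map_eq_zero' (AddMonoidHom.mk' (evalFun A B D S.X₃) ?_)).2 ?_
    · intro a b
      ext (α : S.X₃ →ₗ[A] D)
      exact α.map_add a b
    intro z
    refine ⟨fun hz => ?_, fun hz => by rw [hz, map_zero]⟩
    obtain ⟨y, rfl⟩ := hg z
    have hz' (β : S.X₃ →ₗ[A] D) : β (S.g.hom y) = 0 := LinearMap.congr_fun hz β
    have := hS'.epi_g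
    let θ : dualObj A B D S.X₁ ⟶ ModuleCat.of B D :=
      hS'.exact.desc (ModuleCat.ofHom (evalFun A B D S.X₂ y)) (by
        ext (β : S.X₃ →ₗ[A] D)
        exact hz' β)
    have hθ (μ : S.X₂ →ₗ[A] D) : θ.hom (μ ∘ₗ S.f.hom) = μ y :=
      LinearMap.congr_fun (congrArg ModuleCat.Hom.hom (hS'.exact.g_desc
        (ModuleCat.ofHom (evalFun A B D S.X₂ y)) _)) μ
    obtain ⟨x, hx⟩ := h₁.bijective.2 θ.hom
    have : S.f.hom x = y := h₂.bijective.1 (by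
      ext (μ : S.X₂ →ₗ[A] D)
      rw [evalFun_apply, evalFun_apply, ← hθ, ← hx]
      rfl)
    rw [← this, hfg.apply_apply_eq_zero]
  · intro θ
    obtain ⟨ψ, hψ⟩ := exists_extension_of_ext_one hS' (h₁.extDual 1 one_pos) (ModuleCat.ofHom θ)
    obtain ⟨y, hy⟩ := h₂.bijective.2 ψ.hom
    refine ⟨S.g.hom y, ?_⟩
    ext (β : S.X₃ →ₗ[A] D)
    have := LinearMap.congr_fun (congrArg ModuleCat.Hom.hom hψ) β
    refine Eq.trans ?_ this
    change _ = ψ.hom (β ∘ₗ S.g.hom)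
    rw [← hy]
    rfl

end TwoOutOfThree

variable {B}

lemma TotallyReflexive.of_retract {M N : ModuleCat.{u} A} (r : Retract M N)
    (hN : TotallyReflexive A B D N) : TotallyReflexive A B D M := by
  have hr (x : M) : r.r.hom (r.i.hom x) = x :=
    LinearMap.congr_fun (congrArg ModuleCat.Hom.hom r.retract) x
  have := hN.finite
  refine ⟨Module.Finite.of_surjective r.r.hom fun x => ⟨r.i.hom x, hr x⟩,
    hN.ext.of_retract r, hN.extDual.of_retract
      ⟨dualMap A B D r.r, dualMap A B D r.i, ?_⟩, ?_, ?_⟩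
  · rw [dualMap_comp, r.retract]
    rfl
  · intro x y h
    rw [← hr x, ← hr y]
    congr 1
    apply hN.bijective.1
    ext (α : N →ₗ[A] D)
    exact LinearMap.congr_fun h (α ∘ₗ r.i.hom)
  · intro θ
    obtain ⟨y, hy⟩ := hN.bijective.2 (θ ∘ₗ (dualMap A B D r.i).hom)
    refine ⟨r.r.hom y, ?_⟩
    ext (α : M →ₗ[A] D)
    refine (LinearMap.congr_fun hy (α ∘ₗ r.r.hom)).trans ?_
    change θ ((α ∘ₗ r.r.hom) ∘ₗ r.i.hom) = θ α
    congr 1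
    refine LinearMap.ext (f := (α ∘ₗ r.r.hom) ∘ₗ r.i.hom) (g := α) fun x => ?_
    simp [hr]

end TotallyReflexive

/-! ### The Auslander transpose and Gorenstein projective modules -/

section Transpose

/-- The natural map from `A` to the `B`-linear endomorphisms of `D` is bijective. -/
structure EndBijective (A B D : Type u) [Ring A] [Ring B] [AddCommGroup D] [Module A D]
    [Module B D] [SMulCommClass A B D] : Prop where
  eq_zero : ∀ a : A, (∀ d : D, a • d = 0) → a = 0
  exists_smul : ∀ θ : D →ₗ[B] D, ∃ a : A, ∀ d, θ d = a • d

variable {A B D : Type u} [Ring A] [Ring B] [AddCommGroup D] [Module A D] [Module B D]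
  [SMulCommClass A B D]

/-- Dual basis argument: with a section `s` of `Aⁿ → P`, the functionals `x ↦ s(x)ₖ • d` span `P*`,
and on them the claim reduces to `A ≅ End_B(D)`. -/
lemma evalFun_bijective_of_isFGProj (h : EndBijective A B D) {P : ModuleCat.{u} A}
    (hP : IsFGProj P) : Function.Bijective (evalFun A B D P) := by
  obtain ⟨h1, h2⟩ := hP
  obtain ⟨n, f, hf⟩ := Module.Finite.exists_fin' A P
  obtain ⟨s, hs⟩ := Module.projective_lifting_property f LinearMap.id hf
  have hfs (x : P) : f (s x) = x := LinearMap.congr_fun hs x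
  let c (k : Fin n) (d : D) : P →ₗ[A] D :=
    (LinearMap.toSpanSingleton A D d) ∘ₗ (LinearMap.proj k) ∘ₗ s
  have hc (k : Fin n) (d : D) (x : P) : c k d x = s x k • d := rfl
  have hsum (v : Fin n → A) : v = ∑ k, v k • (Pi.single k 1 : Fin n → A) := by
    ext j; simp [Finset.sum_apply, Pi.single_apply]
  constructor
  · intro x y hxy
    rw [← hfs x, ← hfs y]
    congr 1
    ext k
    rw [← sub_eq_zero]
    refine h.eq_zero _ fun d => ?_
    rw [sub_smul, sub_eq_zero]
    exact LinearMap.congr_fun hxy (c k d)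
  · intro θ
    -- Restricted to the `k`-th coordinate functionals, `θ` is a `B`-endomorphism of `D`, hence
    -- multiplication by a scalar `a k`; these scalars are the coordinates of the preimage.
    let θk (k : Fin n) : D →ₗ[B] D :=
      { toFun := fun d => θ (c k d)
        map_add' := fun d d' => by
          refine Eq.trans (congrArg θ ?_) (θ.map_add _ _)
          refine LinearMap.ext fun x => ?_
          exact smul_add _ _ _
        map_smul' := fun b d => by
          refine Eq.trans (congrArg θ ?_) (θ.map_smul _ _)
          refine LinearMap.ext fun x => ?_
          exact smul_comm _ _ _ }
    choose a ha using fun k => h.exists_smul (θk k)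
    refine ⟨f (∑ k, a k • (Pi.single k 1 : Fin n → A)), ?_⟩
    ext (α : P →ₗ[A] D)
    have hα : α = ∑ k, c k (α (f (Pi.single k 1))) := by
      ext x
      conv_lhs => rw [← hfs x, hsum (s x)]
      simp [hc, map_sum]
    have h3 : θ α = ∑ k, θ (c k (α (f (Pi.single k 1)))) := by
      conv_lhs => rw [hα]
      exact map_sum θ _ _
    rw [evalFun_apply, h3, map_sum, map_sum]
    refine Finset.sum_congr rfl fun k _ => ?_
    rw [map_smul, map_smul]
    exact (ha k _).symm

lemma projective_of_isFGProj {P : ModuleCat.{u} A} (hP : IsFGProj P) : Projective P := by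
  have := hP.2
  exact (IsProjective.iff_projective P).1 this

lemma TotallyReflexive.of_isFGProj [Module.Finite B D] [Module.Projective B D]
    (h : EndBijective A B D) {P : ModuleCat.{u} A} (hP : IsFGProj P) :
    TotallyReflexive A B D P := by
  have := projective_of_isFGProj hP
  have := projective_of_isFGProj (hP.dualObj A B D)
  exact ⟨hP.1, .of_projective _, .of_projective _, evalFun_bijective_of_isFGProj h hP⟩

/-- The short exact sequence `0 → ker g → M → N → 0`. -/
def kerShortComplex {M N : ModuleCat.{u} A} (g : M ⟶ N) : ShortComplex (ModuleCat.{u} A) :=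
  ShortComplex.mk (ModuleCat.ofHom (LinearMap.ker g.hom).subtype) g
    (by ext x; exact x.2)

lemma kerShortComplex_shortExact {M N : ModuleCat.{u} A} (g : M ⟶ N)
    (hg : Function.Surjective g.hom) : (kerShortComplex g).ShortExact :=
  shortExact_of_maps (Submodule.subtype_injective _)
    (LinearMap.exact_subtype_ker_map g.hom) hg

lemma cokernel_π_surjective {M N : ModuleCat.{u} A} (f : M ⟶ N) :
    Function.Surjective (cokernel.π f).hom :=
  (ModuleCat.epi_iff_surjective _).1 inferInstance

lemma cokernel_exact {M N : ModuleCat.{u} A} (f : M ⟶ N) :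
    Function.Exact f.hom (cokernel.π f).hom :=
  (ShortComplex.ShortExact.moduleCat_exact_iff_function_exact _).1
    (ShortComplex.exact_of_g_is_cokernel (ShortComplex.mk f (cokernel.π f) (by simp))
      (cokernelIsCokernel f))

/-- The cokernel of `f` is isomorphic to any `Q` with an exact sequence `M → N → Q → 0`. -/
lemma nonempty_iso_cokernel {M N Q : ModuleCat.{u} A} (f : M ⟶ N) (g : N ⟶ Q)
    (hfg : Function.Exact f.hom g.hom) (hg : Function.Surjective g.hom) :
    Nonempty (Q ≅ cokernel f) := by
  let S := ShortComplex.mk f g (by ext x; exact hfg.apply_apply_eq_zero x)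
  have hS : S.Exact := (ShortComplex.ShortExact.moduleCat_exact_iff_function_exact S).2 hfg
  have : Epi S.g := (ModuleCat.epi_iff_surjective _).2 hg
  exact ⟨hS.gIsCokernel.coconePointUniqueUpToIso (colimit.isColimit _)⟩

/-- Cut `0 → M → P₀ → P₁ → T → 0` at the image `I` of `f`. Then `Ext¹(T)` is the obstruction to
extending functionals from `I` to `P₁`, `Ext²(T) ≅ Ext¹(I)` the one to extending from `M` to `P₀`,
and `Extⁿ⁺²(T) ≅ Extⁿ(M)` for `n > 0`. -/
lemma extVanish_iff_of_dual_presentation (D' : ModuleCat.{u} B) {M P₀ P₁ T : ModuleCat.{u} B}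
    (i : M ⟶ P₀) (f : P₀ ⟶ P₁) (g : P₁ ⟶ T) [Projective P₀] [Projective P₁]
    (hi : Function.Injective i.hom) (hif : Function.Exact i.hom f.hom)
    (hfg : Function.Exact f.hom g.hom) (hg : Function.Surjective g.hom) :
    ExtVanish D' T ↔ ExtVanish D' M ∧ (∀ φ : M →ₗ[B] D', ∃ ψ : P₀ →ₗ[B] D', ψ ∘ₗ i.hom = φ) ∧
      ∀ φ : LinearMap.range f.hom →ₗ[B] D', ∃ ψ : P₁ →ₗ[B] D',
        ψ ∘ₗ (LinearMap.range f.hom).subtype = φ := by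
  let I := LinearMap.range f.hom
  let S₁ : ShortComplex (ModuleCat.{u} B) := ShortComplex.mk (ModuleCat.ofHom I.subtype) g
    (by ext ⟨_, x, rfl⟩; exact hfg.apply_apply_eq_zero x)
  let S₂ : ShortComplex (ModuleCat.{u} B) := ShortComplex.mk i
    (ModuleCat.ofHom (X := P₀) (Y := I) f.hom.rangeRestrict)
    (by ext x; exact hif.apply_apply_eq_zero x)
  have h₁ : S₁.ShortExact := by
    refine shortExact_of_maps (Submodule.subtype_injective _) ?_ hg
    intro x
    rw [hfg x]
    exact ⟨fun ⟨y, hy⟩ => ⟨⟨x, y, hy⟩, rfl⟩, fun ⟨⟨_, y, hy⟩, hx⟩ => ⟨y, hy.trans hx⟩⟩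
  have h₂ : S₂.ShortExact := by
    refine shortExact_of_maps hi ?_ f.hom.surjective_rangeRestrict
    intro x
    rw [← hif x]
    exact ⟨fun h => congrArg Subtype.val h, fun h => Subtype.ext h⟩
  have e₁ : ExtVanish D' P₁ := .of_projective _
  have e₀ : ExtVanish D' P₀ := .of_projective _
  constructor
  · intro h
    have hI : ExtVanish D' (ModuleCat.of B I) := ExtVanish.left h₁ e₁ h
    refine ⟨ExtVanish.left h₂ e₀ hI, fun φ => ?_, fun φ => ?_⟩
    · obtain ⟨ψ, hψ⟩ := exists_extension_of_ext_one h₂ (hI 1 one_pos) (ModuleCat.ofHom φ)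
      exact ⟨ψ.hom, congrArg ModuleCat.Hom.hom hψ⟩
    · obtain ⟨ψ, hψ⟩ := exists_extension_of_ext_one h₁ (h 1 one_pos) (ModuleCat.ofHom φ)
      exact ⟨ψ.hom, congrArg ModuleCat.Hom.hom hψ⟩
  · rintro ⟨hM, h3, h4⟩
    refine ExtVanish.right h₁ (ExtVanish.right h₂ hM e₀ fun φ => ?_) e₁ fun φ => ?_
    · obtain ⟨ψ, hψ⟩ := h3 φ.hom
      exact ⟨ModuleCat.ofHom ψ, by ext1; exact hψ⟩
    · obtain ⟨ψ, hψ⟩ := h4 φ.hom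
      exact ⟨ModuleCat.ofHom ψ, by ext1; exact hψ⟩

variable [Module.Finite B D] [Module.Projective B D]

/-- Applied to `0 → M* → P₀* → P₁* → T → 0`, with `P₀` and `P₁` reflexive, the two extension
conditions become surjectivity and injectivity of `M → M**`. The right-hand side does not mention
`T`, so the choice of transpose is immaterial. -/
lemma IsTranspose.extVanish_iff (h : EndBijective A B D) {M : ModuleCat.{u} A}
    {T : ModuleCat.{u} B} (hT : IsTranspose A B D M T) :
    ExtVanish (ModuleCat.of B D) T ↔ ExtVanish (ModuleCat.of B D) (dualObj A B D M) ∧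
      Function.Bijective (evalFun A B D M) := by
  obtain ⟨P₁, P₀, d₁, d₀, hP₁, hP₀, hd₀, hd, ⟨e⟩⟩ := hT
  have := projective_of_isFGProj (hP₁.dualObj A B D)
  have := projective_of_isFGProj (hP₀.dualObj A B D)
  have hr₁ := evalFun_bijective_of_isFGProj h hP₁
  have hr₀ := evalFun_bijective_of_isFGProj h hP₀
  have heT : ExtVanish (ModuleCat.of B D) T ↔
      ExtVanish (ModuleCat.of B D) (cokernel (dualMap A B D d₁)) :=
    ⟨ExtVanish.of_retract (Retract.ofIso e.symm), ExtVanish.of_retract (Retract.ofIso e)⟩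
  have hex := dualMap_exact (D := D) B d₁ d₀ hd hd₀
  rw [heT, extVanish_iff_of_dual_presentation (ModuleCat.of B D) (dualMap A B D d₀)
    (dualMap A B D d₁) (cokernel.π _) (dualMap_injective B d₀ hd₀)
    hex (cokernel_exact _) (cokernel_π_surjective _)]
  refine and_congr_right fun _ => ?_
  constructor
  · rintro ⟨h3, h4⟩
    constructor
    · intro m m' hm
      obtain ⟨p, hp⟩ := hd₀ (m - m')
      have hp0 (α : M →ₗ[A] D) : α (d₀.hom p) = 0 := by
        rw [hp, map_sub, sub_eq_zero]
        exact LinearMap.congr_fun hm α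
      let F := (dualMap A B D d₁).hom
      -- If every functional kills `d₀ p`, evaluation at `p` vanishes on `ker d₁* = M*` and so lives
      -- on the image of `d₁*`. Its extension to `P₁*` is evaluation at some `q`, which forces `p =
      -- d₁ q`.
      have hker : LinearMap.ker F ≤ LinearMap.ker (evalFun A B D P₀ p) := by
        intro β hβ
        obtain ⟨α, rfl⟩ := (hex β).1 hβ
        exact hp0 α
      let φ : LinearMap.range F →ₗ[B] D :=
        (LinearMap.ker F).liftQ (evalFun A B D P₀ p) hker ∘ₗ
          F.quotKerEquivRange.symm.toLinearMap
      have hφ (β : dualObj A B D P₀) : φ ⟨F β, β, rfl⟩ = evalFun A B D P₀ p β := by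
        have : F.quotKerEquivRange.symm ⟨F β, β, rfl⟩ = (LinearMap.ker F).mkQ β := by
          rw [LinearEquiv.symm_apply_eq]
          rfl
        change (LinearMap.ker F).liftQ _ hker (F.quotKerEquivRange.symm ⟨F β, β, rfl⟩) = _
        rw [this]
        rfl
      obtain ⟨ψ, hψ⟩ := h4 φ
      obtain ⟨q, rfl⟩ := hr₁.2 ψ
      have : d₁.hom q = p := hr₀.1 (by
        refine LinearMap.ext fun β => ?_
        rw [← hφ, ← hψ]
        rfl)
      rw [← sub_eq_zero, ← hp, ← this, hd.apply_apply_eq_zero]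
    · intro θ
      obtain ⟨ψ, hψ⟩ := h3 θ
      obtain ⟨p, rfl⟩ := hr₀.2 ψ
      refine ⟨d₀.hom p, ?_⟩
      rw [← hψ]
      rfl
  · intro hM
    constructor
    · intro θ
      obtain ⟨m, rfl⟩ := hM.2 θ
      obtain ⟨p, rfl⟩ := hd₀ m
      exact ⟨evalFun A B D P₀ p, rfl⟩
    · intro φ
      obtain ⟨p, hp⟩ := hr₀.2 (φ ∘ₗ (dualMap A B D d₁).hom.rangeRestrict)
      have hp' (β : P₀ →ₗ[A] D) :
          β p = φ ⟨(dualMap A B D d₁).hom β, β, rfl⟩ := LinearMap.congr_fun hp β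
      obtain ⟨q, rfl⟩ := (hd p).1 (hM.1 (by
        ext (α : M →ₗ[A] D)
        rw [evalFun_apply, evalFun_apply, map_zero]
        refine (hp' (α ∘ₗ d₀.hom)).trans ?_
        rw [← map_zero φ]
        congr 1
        exact Subtype.ext (hex.apply_apply_eq_zero (show M →ₗ[A] D from α))))
      refine ⟨evalFun A B D P₁ q, ?_⟩
      ext ⟨_, (β : P₀ →ₗ[A] D), rfl⟩
      exact hp' β

lemma isGorensteinProjectiveModule_iff [IsNoetherianRing A] (h : EndBijective A B D)
    (M : ModuleCat.{u} A) :
    IsGorensteinProjectiveModule A B D M ↔ TotallyReflexive A B D M := by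
  constructor
  · rintro ⟨h1, h2, T, hT, h3⟩
    obtain ⟨h4, h5⟩ := (hT.extVanish_iff h).1 h3
    exact ⟨h1, h2, h4, h5⟩
  · rintro ⟨h1, h2, h4, h5⟩
    obtain ⟨n, f, hf⟩ := Module.Finite.exists_fin' A M
    obtain ⟨m, g, hg⟩ := Module.Finite.exists_fin' A (LinearMap.ker f)
    have hT : IsTranspose A B D M (cokernel (dualMap A B D
        (ModuleCat.ofHom ((LinearMap.ker f).subtype ∘ₗ g)))) := by
      refine ⟨ModuleCat.of A (Fin m → A), ModuleCat.of A (Fin n → A), _, ModuleCat.ofHom f,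
        ?_, ?_, hf, ?_, ⟨Iso.refl _⟩⟩
      · exact ⟨inferInstanceAs (Module.Finite A (Fin m → A)),
          inferInstanceAs (Module.Projective A (Fin m → A))⟩
      · exact ⟨inferInstanceAs (Module.Finite A (Fin n → A)),
          inferInstanceAs (Module.Projective A (Fin n → A))⟩
      · intro x
        constructor
        · intro hx
          obtain ⟨y, hy⟩ := hg ⟨x, hx⟩
          exact ⟨y, congrArg Subtype.val hy⟩
        · rintro ⟨y, rfl⟩
          exact (g y).2
    exact ⟨h1, h2, _, hT, (hT.extVanish_iff h).2 ⟨h4, h5⟩⟩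

variable [SMulCommClass B A D]

/-- The evaluation map of `M` as a morphism `M ⟶ M**`. -/
def evalHom (M : ModuleCat.{u} A) : M ⟶ dualObj B A D (dualObj A B D M) :=
  ModuleCat.ofHom (Y := dualObj A B D M →ₗ[B] D)
    { toFun := evalFun A B D M
      map_add' := fun x y => by
        ext (α : M →ₗ[A] D)
        exact α.map_add x y
      map_smul' := fun a x => by
        ext (α : M →ₗ[A] D)
        exact α.map_smul a x }

/-- `P₀* → P₁* → T → 0` is a projective presentation of `T`, and dualizing it returns `P₁ → P₀`
because finitely generated projectives are reflexive. -/
lemma IsTranspose.symm (h : EndBijective A B D) {M : ModuleCat.{u} A}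
    {T : ModuleCat.{u} B} (hT : IsTranspose A B D M T) : IsTranspose B A D T M := by
  obtain ⟨P₁, P₀, d₁, d₀, hP₁, hP₀, hd₀, hd, ⟨e⟩⟩ := hT
  refine ⟨dualObj A B D P₀, dualObj A B D P₁, dualMap A B D d₁, cokernel.π _ ≫ e.inv,
    hP₀.dualObj A B D, hP₁.dualObj A B D, ?_, ?_, ?_⟩
  · exact (ModuleCat.epi_iff_surjective _).1 inferInstance
  · intro x
    rw [← cokernel_exact (dualMap A B D d₁) x]
    refine ⟨fun hx => ?_, fun hx => ?_⟩
    · have := congrArg e.hom.hom hx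
      simpa using this
    · simp [hx]
  · have (P : ModuleCat.{u} A) (hP : IsFGProj P) : IsIso (evalHom (B := B) (D := D) P) :=
      (ConcreteCategory.isIso_iff_bijective _).2 (evalFun_bijective_of_isFGProj h hP)
    have h₁ := this P₁ hP₁
    have h₀ := this P₀ hP₀
    obtain ⟨e'⟩ := nonempty_iso_cokernel d₁ d₀ hd hd₀
    exact ⟨e' ≪≫ cokernel.mapIso _ _ (asIso (evalHom (B := B) (D := D) P₁))
      (asIso (evalHom (B := B) (D := D) P₀)) rfl⟩

/-- Passing to the transpose interchanges the two Ext conditions in the definition. -/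
lemma IsTranspose.isGorensteinProjectiveModule [IsNoetherianRing A] (h : EndBijective A B D)
    {M : ModuleCat.{u} A} {T : ModuleCat.{u} B} (hT : IsTranspose A B D M T)
    (hM : IsGorensteinProjectiveModule A B D M) : IsGorensteinProjectiveModule B A D T := by
  have hM' := (isGorensteinProjectiveModule_iff h M).1 hM
  refine ⟨?_, (hT.extVanish_iff h).2 ⟨hM'.extDual, hM'.bijective⟩, M, hT.symm h, hM.2.1⟩
  obtain ⟨P₁, P₀, d₁, d₀, hP₁, hP₀, hd₀, hd, ⟨e⟩⟩ := hT
  have := (hP₁.dualObj A B D).1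
  exact Module.Finite.of_surjective (cokernel.π (dualMap A B D d₁) ≫ e.inv).hom
    ((ModuleCat.epi_iff_surjective _).1 inferInstance)

end Transpose

/-! ### The regular bimodule -/

section SelfDual

variable (R : Type u) [Ring R]

lemma endBijective_op_self : EndBijective Rᵐᵒᵖ R R where
  eq_zero a h := by simpa using h 1
  exists_smul θ := ⟨MulOpposite.op (θ 1), fun d => by
    conv_lhs => rw [← mul_one d, ← smul_eq_mul, map_smul]
    rfl⟩

end SelfDual

/-! ### Projective dimension of modules -/

section ModulePd

variable {A : Type u} [Ring A]

lemma ModulePdLE.finite_and_hasProjectiveDimensionLE (n : ℕ) :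
    ∀ M : ModuleCat.{u} A, ModulePdLE M n →
      Module.Finite A M ∧ HasProjectiveDimensionLE M n := by
  induction n with
  | zero =>
    rintro M ⟨P, d, ε, hP, h0, hε, hex, -⟩
    have hz : d 0 = 0 := (h0 1 one_pos).eq_of_src _ _
    have hinj : Function.Injective ε.hom := by
      rw [injective_iff_map_eq_zero]
      intro x hx
      obtain ⟨y, rfl⟩ := (hex x).1 hx
      rw [hz]
      rfl
    have : IsIso ε := (ConcreteCategory.isIso_iff_bijective ε).2 ⟨hinj, hε⟩
    have hM := (hP 0).of_iso (asIso ε).symm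
    have := projective_of_isFGProj hM
    exact ⟨hM.1, inferInstanceAs (HasProjectiveDimensionLT M 1)⟩
  | succ n ih =>
    rintro M ⟨P, d, ε, hP, h0, hε, hex, hex'⟩
    have hS := kerShortComplex_shortExact ε hε
    let δ : P 1 ⟶ ModuleCat.of A (LinearMap.ker ε.hom) := ModuleCat.ofHom
      ((d 0).hom.codRestrict (LinearMap.ker ε.hom) fun x => hex.apply_apply_eq_zero x)
    have hK := ih (ModuleCat.of A (LinearMap.ker ε.hom))
      ⟨fun i => P (i + 1), fun i => d (i + 1), δ, fun i => hP (i + 1),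
        fun i hi => h0 (i + 1) (by lia),
        fun ⟨x, hx⟩ => by
          obtain ⟨y, hy⟩ := (hex x).1 hx
          exact ⟨y, Subtype.ext hy⟩,
        fun x => by
          rw [← hex' 0 x]
          exact ⟨fun h => congrArg Subtype.val h, fun h => Subtype.ext h⟩,
        fun i => hex' (i + 1)⟩
    have := (hP 0).1
    have := projective_of_isFGProj (hP 0)
    exact ⟨Module.Finite.of_surjective ε.hom hε,
      hS.hasProjectiveDimensionLT_X₃ (n + 1) hK.2
        (hasProjectiveDimensionLT_of_ge (P 0) 1 (n + 1 + 1) (by lia))⟩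

/-- The syzygy of a finite free cover is again finitely generated over a noetherian ring, and its
dimension bound drops by one. -/
lemma modulePdLE_of_hasProjectiveDimensionLE [IsNoetherianRing A] (n : ℕ) :
    ∀ M : ModuleCat.{u} A, Module.Finite A M → HasProjectiveDimensionLE M n →
      ModulePdLE M n := by
  induction n with
  | zero =>
    intro M hM hpd
    have := (projective_iff_hasProjectiveDimensionLE_zero M).2 hpd
    have hM' : IsFGProj M := ⟨hM, (IsProjective.iff_projective M).2 this⟩
    refine ⟨fun i => Nat.casesOn i M fun _ => 0, fun i => 0, 𝟙 M, ?_, ?_,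
      fun x => ⟨x, rfl⟩, ?_, ?_⟩
    · rintro (_ | i)
      · exact hM'
      · exact .of_isZero (isZero_zero _)
    · rintro (_ | i) hi
      · exact absurd hi (lt_irrefl _)
      · exact isZero_zero _
    · intro x
      exact ⟨fun h => ⟨0, h.symm⟩, fun ⟨_, h⟩ => h.symm⟩
    · intro i x
      have := ModuleCat.subsingleton_of_isZero (isZero_zero (ModuleCat.{u} A))
      exact ⟨fun _ => ⟨0, Subsingleton.elim (α := (0 : ModuleCat.{u} A)) _ _⟩, fun _ => rfl⟩
  | succ n ih =>
    intro M hM hpd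
    obtain ⟨m, f, hf⟩ := Module.Finite.exists_fin' A M
    let P₀ := ModuleCat.of A (Fin m → A)
    let f' : P₀ ⟶ M := ModuleCat.ofHom f
    have hP₀ : IsFGProj P₀ := ⟨inferInstanceAs (Module.Finite A (Fin m → A)),
      inferInstanceAs (Module.Projective A (Fin m → A))⟩
    have := projective_of_isFGProj hP₀
    have := hP₀.1
    have hS := kerShortComplex_shortExact f' hf
    have hK := hS.hasProjectiveDimensionLT_X₁ (n + 1)
      (hasProjectiveDimensionLT_of_ge P₀ 1 (n + 1) (by lia)) hpd
    obtain ⟨P, d, ε, hP, h0, hε, hex, hex'⟩ :=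
      ih (ModuleCat.of A (LinearMap.ker f'.hom)) inferInstance hK
    let ι : ModuleCat.of A (LinearMap.ker f'.hom) ⟶ P₀ :=
      ModuleCat.ofHom (LinearMap.ker f'.hom).subtype
    refine ⟨fun i => Nat.casesOn i P₀ P,
      fun i => Nat.casesOn i (ε ≫ ι) d, f', ?_, ?_, hf, ?_, ?_⟩
    · rintro (_ | i)
      exacts [hP₀, hP i]
    · rintro (_ | i) hi
      exacts [absurd hi (by lia), h0 i (by lia)]
    · intro x
      constructor
      · intro hx
        obtain ⟨y, hy⟩ := hε ⟨x, hx⟩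
        exact ⟨y, congrArg Subtype.val hy⟩
      · rintro ⟨y, rfl⟩
        exact (ε.hom y).2
    · rintro (_ | i)
      · intro x
        rw [← hex x]
        exact ⟨fun h => Subtype.ext h, fun h => congrArg Subtype.val h⟩
      · exact hex' i

lemma modulePdLE_iff [IsNoetherianRing A] (M : ModuleCat.{u} A) (n : ℕ) :
    ModulePdLE M n ↔ Module.Finite A M ∧ HasProjectiveDimensionLE M n :=
  ⟨ModulePdLE.finite_and_hasProjectiveDimensionLE n M,
    fun h => modulePdLE_of_hasProjectiveDimensionLE n M h.1 h.2⟩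

/-- If `p` is upwards closed, then the infimum of the set of `n` with `p n` is at most `n` exactly
when `p n` holds. -/
lemma sInf_coe_le_iff {p : ℕ → Prop} (hp : ∀ n m, n ≤ m → p n → p m) (n : ℕ) :
    sInf {m : ℕ∞ | ∃ k : ℕ, m = k ∧ p k} ≤ n ↔ p n := by
  constructor
  · intro h
    have hne : {m : ℕ∞ | ∃ k : ℕ, m = k ∧ p k}.Nonempty := by
      rw [Set.nonempty_iff_ne_empty]
      intro h0
      rw [h0, sInf_empty] at h
      exact absurd h (by simp)
    obtain ⟨k, hk, hpk⟩ := csInf_mem hne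
    rw [hk] at h
    exact hp k n (by exact_mod_cast h) hpk
  · intro h
    exact sInf_le ⟨n, rfl, h⟩

lemma modulePd_le_iff [IsNoetherianRing A] (M : ModuleCat.{u} A) (n : ℕ) :
    modulePd M ≤ n ↔ Module.Finite A M ∧ HasProjectiveDimensionLE M n := by
  rw [← modulePdLE_iff]
  refine sInf_coe_le_iff (p := ModulePdLE M) (fun k m hkm hk => ?_) n
  rw [modulePdLE_iff] at hk ⊢
  have := hk.2
  exact ⟨hk.1, hasProjectiveDimensionLT_of_ge M (k + 1) (m + 1) (by lia)⟩

end ModulePd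

/-! ### Complexes, cohomology and the modules `Cⁱ` -/

section Complexes

variable {A : Type u} [Ring A]

/-- The morphism in `K(proj A)` represented by a chain map. -/
def ofChainMap {X Y : KProj A} (f : cpx X ⟶ cpx Y) : X ⟶ Y :=
  ObjectProperty.homMk ((HomotopyCategory.quotient _ _).map f)

lemma ofChainMap_surjective {X Y : KProj A} (f : X ⟶ Y) :
    ∃ f' : cpx X ⟶ cpx Y, ofChainMap f' = f := by
  obtain ⟨f', hf'⟩ := (HomotopyCategory.quotient _ _).map_surjective
    (show (HomotopyCategory.quotient _ _).obj (cpx X) ⟶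
      (HomotopyCategory.quotient _ _).obj (cpx Y) from f.hom)
  exact ⟨f', ObjectProperty.hom_ext _ hf'⟩

lemma ofChainMap_comp {X Y Z : KProj A} (f : cpx X ⟶ cpx Y) (g : cpx Y ⟶ cpx Z) :
    ofChainMap f ≫ ofChainMap g = ofChainMap (f ≫ g) :=
  ObjectProperty.hom_ext _ ((HomotopyCategory.quotient _ _).map_comp f g).symm

lemma ofChainMap_id (X : KProj A) : ofChainMap (𝟙 (cpx X)) = 𝟙 X :=
  ObjectProperty.hom_ext _ ((HomotopyCategory.quotient _ _).map_id (cpx X))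

lemma nonempty_homotopy_of_eq {X Y : KProj A} {f g : cpx X ⟶ cpx Y}
    (h : ofChainMap f = ofChainMap g) : Nonempty (Homotopy f g) :=
  ⟨HomotopyCategory.homotopyOfEq f g (congrArg (fun k => k.hom) h)⟩

lemma ofChainMap_eq_of_homotopy {X Y : KProj A} {f g : cpx X ⟶ cpx Y}
    (h : Homotopy f g) : ofChainMap f = ofChainMap g :=
  ObjectProperty.hom_ext _ (HomotopyCategory.eq_of_homotopy f g h)

lemma homotopy_apply {K L : CochainComplex (ModuleCat.{u} A) ℤ} {f g : K ⟶ L} (h : Homotopy f g)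
    {i j k : ℤ} (hij : i + 1 = j) (hjk : j + 1 = k) (x : K.X j) :
    (f.f j).hom x = (h.hom k j).hom ((K.d j k).hom x) + (L.d i j).hom ((h.hom j i).hom x) +
      (g.f j).hom x := by
  have := h.comm j
  rw [dNext_eq h.hom (show (ComplexShape.up ℤ).Rel j k from hjk),
    prevD_eq h.hom (show (ComplexShape.up ℤ).Rel i j from hij)] at this
  rw [this]
  rfl

lemma chainMap_apply {K L : CochainComplex (ModuleCat.{u} A) ℤ} (f : K ⟶ L)
    (i j : ℤ) (x : K.X i) : (L.d i j).hom ((f.f i).hom x) = (f.f j).hom ((K.d i j).hom x) :=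
  LinearMap.congr_fun (congrArg ModuleCat.Hom.hom (f.comm i j)) x

section Homology

variable (K : CochainComplex (ModuleCat.{u} A) ℤ)

lemma exists_cycle {j k : ℤ} (hjk : j + 1 = k) (x : K.X j) (hx : (K.d j k).hom x = 0) :
    ∃ c : K.cycles j, (K.iCycles j).hom c = x := by
  refine ⟨K.cyclesMk (C := ModuleCat.{u} A) x k ((ComplexShape.up ℤ).next_eq' hjk) hx, ?_⟩
  exact K.i_cyclesMk (C := ModuleCat.{u} A) x k ((ComplexShape.up ℤ).next_eq' hjk) hx

lemma d_iCycles_apply (j k : ℤ) (c : K.cycles j) :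
    (K.d j k).hom ((K.iCycles j).hom c) = 0 :=
  LinearMap.congr_fun (congrArg ModuleCat.Hom.hom (K.iCycles_d j k)) c

lemma homologyπ_eq_iff {i j : ℤ} (hij : i + 1 = j) (c c' : K.cycles j) :
    (K.homologyπ j).hom c = (K.homologyπ j).hom c' ↔
      ∃ y : K.X i, (K.iCycles j).hom c = (K.iCycles j).hom c' + (K.d i j).hom y := by
  have hex : Function.Exact (K.toCycles i j).hom (K.homologyπ j).hom :=
    (ShortComplex.ShortExact.moduleCat_exact_iff_function_exact _).1
      (ShortComplex.exact_of_g_is_cokernel (ShortComplex.mk _ _ (K.toCycles_comp_homologyπ i j))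
        (K.homologyIsCokernel i j ((ComplexShape.up ℤ).prev_eq' hij)))
  have hinj : Function.Injective (K.iCycles j).hom :=
    (ModuleCat.mono_iff_injective _).1 inferInstance
  have hd (y : K.X i) : (K.iCycles j).hom ((K.toCycles i j).hom y) = (K.d i j).hom y :=
    LinearMap.congr_fun (congrArg ModuleCat.Hom.hom (K.toCycles_i i j)) y
  rw [← sub_eq_zero, ← map_sub, hex]
  constructor
  · rintro ⟨y, hy⟩
    refine ⟨y, ?_⟩
    rw [← hd, hy, map_sub]
    abel
  · rintro ⟨y, hy⟩
    refine ⟨y, hinj ?_⟩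
    rw [hd, map_sub, hy]
    abel

lemma homologyπ_surjective (j : ℤ) : Function.Surjective (K.homologyπ j).hom :=
  (ModuleCat.epi_iff_surjective _).1 inferInstance

end Homology

/-- Elementwise description of the surjectivity of `Hʲ` of a chain map. -/
def SurjectiveOnCohomologyAt {K L : CochainComplex (ModuleCat.{u} A) ℤ} (f : K ⟶ L)
    (j : ℤ) : Prop :=
  ∀ z : L.X j, (L.d j (j + 1)).hom z = 0 → ∃ x : K.X j, (K.d j (j + 1)).hom x = 0 ∧
    ∃ y : L.X (j - 1), z = (f.f j).hom x + (L.d (j - 1) j).hom y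

lemma homologyMap_surjective_iff {K L : CochainComplex (ModuleCat.{u} A) ℤ} (f : K ⟶ L) (j : ℤ) :
    Function.Surjective (HomologicalComplex.homologyMap f j).hom ↔
      SurjectiveOnCohomologyAt f j := by
  have hπ (c : K.cycles j) : (HomologicalComplex.homologyMap f j).hom ((K.homologyπ j).hom c) =
      (L.homologyπ j).hom ((HomologicalComplex.cyclesMap f j).hom c) :=
    LinearMap.congr_fun (congrArg ModuleCat.Hom.hom
      (HomologicalComplex.homologyπ_naturality f j)) c
  have hi (c : K.cycles j) : (L.iCycles j).hom ((HomologicalComplex.cyclesMap f j).hom c) =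
      (f.f j).hom ((K.iCycles j).hom c) :=
    LinearMap.congr_fun (congrArg ModuleCat.Hom.hom
      (HomologicalComplex.cyclesMap_i f j)) c
  constructor
  · intro h z hz
    obtain ⟨c, rfl⟩ := exists_cycle L rfl z hz
    obtain ⟨k, hk⟩ := h ((L.homologyπ j).hom c)
    obtain ⟨b, rfl⟩ := homologyπ_surjective K j k
    rw [hπ] at hk
    obtain ⟨y, hy⟩ := (homologyπ_eq_iff L (sub_add_cancel j 1) _ _).1 hk.symm
    exact ⟨(K.iCycles j).hom b, d_iCycles_apply K j _ b, y, by rw [hy, hi]⟩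
  · intro h l
    obtain ⟨c, rfl⟩ := homologyπ_surjective L j l
    obtain ⟨x, hx, y, hy⟩ := h _ (d_iCycles_apply L j _ c)
    obtain ⟨b, rfl⟩ := exists_cycle K rfl x hx
    refine ⟨(K.homologyπ j).hom b, ?_⟩
    rw [hπ]
    symm
    rw [homologyπ_eq_iff L (sub_add_cancel j 1)]
    exact ⟨y, by rw [hi, hy]⟩

lemma cohomology_map_surjective_iff {X Y : KProj A} (f : cpx X ⟶ cpx Y) (j : ℤ) :
    Function.Surjective ((cohomology A j).map (ofChainMap f)).hom ↔
      SurjectiveOnCohomologyAt f j := by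
  rw [← homologyMap_surjective_iff, ← ModuleCat.epi_iff_surjective, ← ModuleCat.epi_iff_surjective]
  exact (MorphismProperty.epimorphisms (ModuleCat.{u} A)).arrow_mk_iso_iff
    (((Functor.mapArrowFunctor _ _).mapIso
      (HomotopyCategory.homologyFunctorFactors (ModuleCat.{u} A) (ComplexShape.up ℤ) j)).app
        (Arrow.mk f))

lemma cohSurjective_ofChainMap_iff {X Y : KProj A} (f : cpx X ⟶ cpx Y) :
    CohSurjective (ofChainMap f) ↔ ∀ j, SurjectiveOnCohomologyAt f j :=
  forall_congr' fun j => cohomology_map_surjective_iff f j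

/-- The projection `Xⁱ → Cⁱ(X)`. -/
def cokπ (X : KProj A) (i : ℤ) : (cpx X).X i ⟶ cok X i :=
  cokernel.π _

lemma cokπ_surjective (X : KProj A) (i : ℤ) : Function.Surjective (cokπ X i).hom :=
  cokernel_π_surjective _

lemma exact_d_cokπ (X : KProj A) {i j : ℤ} (hij : i + 1 = j) :
    Function.Exact ((cpx X).d i j).hom (cokπ X j).hom := by
  obtain rfl : i = j - 1 := by lia
  exact cokernel_exact _

lemma d_cokπ (X : KProj A) (i : ℤ) : (cpx X).d (i - 1) i ≫ cokπ X i = 0 :=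
  cokernel.condition _

lemma cok_hom_ext {X : KProj A} {i : ℤ} {M : ModuleCat.{u} A} {f g : cok X i ⟶ M}
    (h : cokπ X i ≫ f = cokπ X i ≫ g) : f = g :=
  (cancel_epi (cokernel.π ((cpx X).d (i - 1) i))).1 h

/-- The map `Cⁱ(X) → M` induced by `f : Xⁱ → M`. -/
def cokDesc (X : KProj A) (i : ℤ) {M : ModuleCat.{u} A} (f : (cpx X).X i ⟶ M)
    (hf : (cpx X).d (i - 1) i ≫ f = 0) : cok X i ⟶ M :=
  cokernel.desc _ f hf

lemma cokπ_cokDesc (X : KProj A) (i : ℤ) {M : ModuleCat.{u} A} (f : (cpx X).X i ⟶ M)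
    (hf : (cpx X).d (i - 1) i ≫ f = 0) : cokπ X i ≫ cokDesc X i f hf = f :=
  cokernel.π_desc _ _ _

lemma cokDesc_apply (X : KProj A) (i : ℤ) {M : ModuleCat.{u} A} (f : (cpx X).X i ⟶ M)
    (hf : (cpx X).d (i - 1) i ≫ f = 0) (x : (cpx X).X i) :
    (cokDesc X i f hf).hom ((cokπ X i).hom x) = f.hom x :=
  LinearMap.congr_fun (congrArg ModuleCat.Hom.hom (cokπ_cokDesc X i f hf)) x

/-- The map on `Cⁱ` induced by a chain map. -/
def cokMap {X Y : KProj A} (f : cpx X ⟶ cpx Y) (i : ℤ) : cok X i ⟶ cok Y i :=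
  cokDesc X i (f.f i ≫ cokπ Y i) (by
    rw [← f.comm_assoc, d_cokπ, comp_zero])

lemma cokπ_cokMap {X Y : KProj A} (f : cpx X ⟶ cpx Y) (i : ℤ) :
    cokπ X i ≫ cokMap f i = f.f i ≫ cokπ Y i :=
  cokπ_cokDesc _ _ _ _

lemma cokMap_apply {X Y : KProj A} (f : cpx X ⟶ cpx Y) (i : ℤ) (x : (cpx X).X i) :
    (cokMap f i).hom ((cokπ X i).hom x) = (cokπ Y i).hom ((f.f i).hom x) :=
  LinearMap.congr_fun (congrArg ModuleCat.Hom.hom (cokπ_cokMap f i)) x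

lemma cok_finite (X : KProj A) (i : ℤ) : Module.Finite A (cok X i) := by
  have := (X.property i).1
  exact Module.Finite.of_surjective (cokπ X i).hom (cokπ_surjective X i)

/-- A property of modules that is inherited by retracts and by direct sums with finitely generated
projective modules. -/
structure IsStableProperty (P : ModuleCat.{u} A → Prop) : Prop where
  of_retract : ∀ {M N : ModuleCat.{u} A}, Retract M N → P N → P M
  biprod : ∀ {M F : ModuleCat.{u} A}, P M → IsFGProj F → P (M ⊞ F)

lemma IsStableProperty.of_iso {P : ModuleCat.{u} A → Prop} (hP : IsStableProperty P)
    {M N : ModuleCat.{u} A} (e : M ≅ N) (h : P N) : P M :=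
  hP.of_retract (Retract.ofIso e) h

/-- If `Y` is a retract of `X` in `K(proj A)`, then `Cⁱ(Y)` is a retract of
`Cⁱ(X) ⊞ Yⁱ⁺¹`. -/
lemma nonempty_retract_cok {X Y : KProj A} (r : Retract Y X) (i : ℤ) :
    Nonempty (Retract (cok Y i) (cok X i ⊞ (cpx Y).X (i + 1))) := by
  obtain ⟨f, hf⟩ := ofChainMap_surjective r.i
  obtain ⟨g, hg⟩ := ofChainMap_surjective r.r
  have hfg : ofChainMap (f ≫ g) = ofChainMap (𝟙 (cpx Y)) := by
    rw [← ofChainMap_comp, hf, hg, r.retract, ofChainMap_id]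
  obtain ⟨h⟩ := nonempty_homotopy_of_eq hfg
  -- The homotopy writes `g f - 1` as `h d + d h`. In `Cⁱ(Y)` the term `d h` dies, and `h d` factors
  -- through `Yⁱ⁺¹`, so the second component subtracts it.
  refine ⟨⟨biprod.lift (cokMap f i) (cokDesc Y i ((cpx Y).d i (i + 1)) (by simp)),
    biprod.desc (cokMap g i) (-(h.hom (i + 1) i ≫ cokπ Y i)), ?_⟩⟩
  rw [biprod.lift_desc]
  apply cok_hom_ext
  ext x
  have hx := homotopy_apply h (sub_add_cancel i 1) rfl x
  have hz := (exact_d_cokπ Y (sub_add_cancel i 1)).apply_apply_eq_zero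
  change (cokMap g i).hom ((cokMap f i).hom ((cokπ Y i).hom x)) +
    -(cokπ Y i).hom ((h.hom (i + 1) i).hom
      ((cokDesc Y i ((cpx Y).d i (i + 1)) (by simp)).hom ((cokπ Y i).hom x))) = (cokπ Y i).hom x
  rw [cokMap_apply, cokMap_apply, cokDesc_apply]
  change (g.f i).hom ((f.f i).hom x) = _ + _ + x at hx
  rw [hx, map_add, map_add, hz]
  abel

/-- This makes a stable property of `Cⁱ` an invariant of the homotopy type, although `Cⁱ` itself is
not one. -/
lemma IsStableProperty.cok_of_retract {P : ModuleCat.{u} A → Prop} (hP : IsStableProperty P)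
    {X Y : KProj A} (r : Retract Y X) (i : ℤ) (h : P (cok X i)) : P (cok Y i) := by
  obtain ⟨r'⟩ := nonempty_retract_cok r i
  exact hP.of_retract r' (hP.biprod h (Y.property (i + 1)))

lemma IsStableProperty.cok_iff_of_iso {P : ModuleCat.{u} A → Prop} (hP : IsStableProperty P)
    {X Y : KProj A} (e : X ≅ Y) (i : ℤ) : P (cok X i) ↔ P (cok Y i) :=
  ⟨hP.cok_of_retract (Retract.ofIso e.symm) i, hP.cok_of_retract (Retract.ofIso e) i⟩

/-- The shift of `X`, as an explicit complex. -/
def shiftObj (X : KProj A) (n : ℤ) : KProj A where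
  obj := (HomotopyCategory.quotient _ _).obj ((cpx X)⟦n⟧)
  property i := X.property (i + n)

lemma nonempty_shift_iso (X : KProj A) (n : ℤ) : Nonempty (X⟦n⟧ ≅ shiftObj X n) :=
  ⟨ObjectProperty.isoMk _ (((projComplexes A).ι.commShiftIso n).app X ≪≫
    ((HomotopyCategory.quotient (ModuleCat.{u} A) (ComplexShape.up ℤ)).commShiftIso n).symm.app
      (cpx X))⟩

/-- The differential of the shift is `(-1)ⁿ d`, which has the same image as `d`. -/
lemma nonempty_cok_shiftObj_iso (X : KProj A) (n i : ℤ) :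
    Nonempty (cok X (i + n) ≅ cok (shiftObj X n) i) := by
  refine nonempty_iso_cokernel (N := (cpx X).X (i + n)) ((cpx (shiftObj X n)).d (i - 1) i)
    (cokπ X (i + n)) ?_ (cokπ_surjective X _)
  have h1 : (cpx (shiftObj X n)).d (i - 1) i = n.negOnePow • (cpx X).d (i - 1 + n) (i + n) := rfl
  rw [h1]
  intro x
  rw [exact_d_cokπ X (show i - 1 + n + 1 = i + n by lia) x]
  obtain h | h := Int.even_or_odd n
  · rw [Int.negOnePow_even n h, one_smul]
    rfl
  · rw [Int.negOnePow_odd n h, Units.neg_smul, one_smul]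
    constructor
    · rintro ⟨y, rfl⟩
      exact ⟨-y, (congrArg Neg.neg
        (LinearMap.map_neg ((cpx X).d (i - 1 + n) (i + n)).hom y)).trans (neg_neg _)⟩
    · rintro ⟨y, rfl⟩
      exact ⟨-y, LinearMap.map_neg ((cpx X).d (i - 1 + n) (i + n)).hom y⟩

lemma IsStableProperty.cok_shift_iff {P : ModuleCat.{u} A → Prop} (hP : IsStableProperty P)
    (X : KProj A) (n i : ℤ) : P (cok (X⟦n⟧) i) ↔ P (cok X (i + n)) := by
  obtain ⟨e⟩ := nonempty_shift_iso X n
  obtain ⟨e'⟩ := nonempty_cok_shiftObj_iso X n i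
  rw [hP.cok_iff_of_iso e]
  exact ⟨hP.of_iso e', hP.of_iso e'.symm⟩

/-- The mapping cone of a chain map, as an object of `K(proj A)`. -/
def coneObj {X Y : KProj A} (f : cpx X ⟶ cpx Y) : KProj A where
  obj := (HomotopyCategory.quotient _ _).obj (CochainComplex.mappingCone f)
  property i := IsFGProj.of_iso ((X.property (i + 1)).biprod (Y.property i))
    (HomologicalComplex.homotopyCofiber.XIsoBiprod f i (i + 1) (by simp))

lemma nonempty_iso_coneObj {X Y : KProj A} (f : cpx X ⟶ cpx Y) {Z : KProj A} {g : Y ⟶ Z}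
    {h : Z ⟶ X⟦(1 : ℤ)⟧} (hT : Triangle.mk (ofChainMap f) g h ∈ distTriang (KProj A)) :
    Nonempty (Z ≅ coneObj f) := by
  have hT' := (projComplexes A).ι.map_distinguished _ hT
  let e := isoTriangleOfIso₁₂ _ _ hT'
    (HomotopyCategory.mappingCone_triangleh_distinguished f) (Iso.refl _) (Iso.refl _)
    ((Category.comp_id _).trans (Category.id_comp _).symm)
  exact ⟨ObjectProperty.isoMk _ (Triangle.π₃.mapIso e)⟩

lemma nonempty_shift_iso_coneObj {X Y Z : KProj A} (g : cpx Y ⟶ cpx Z) {f : X ⟶ Y}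
    {h : Z ⟶ X⟦(1 : ℤ)⟧} (hT : Triangle.mk f (ofChainMap g) h ∈ distTriang (KProj A)) :
    Nonempty (X⟦(1 : ℤ)⟧ ≅ coneObj g) :=
  nonempty_iso_coneObj g (rot_of_distTriang _ hT)

end Complexes

/-! ### Elements of biproducts -/

section BiprodElements

variable {A : Type u} [Ring A]

lemma biprod_desc_apply {M N L : ModuleCat.{u} A} (f : M ⟶ L) (g : N ⟶ L)
    (x : (M ⊞ N : ModuleCat.{u} A)) :
    (biprod.desc f g).hom x =
      f.hom ((biprod.fst (X := M) (Y := N)).hom x) +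
        g.hom ((biprod.snd (X := M) (Y := N)).hom x) := by
  rw [biprod.desc_eq]
  rfl

lemma biprod_lift_fst_apply {M N L : ModuleCat.{u} A} (f : L ⟶ M) (g : L ⟶ N) (x : L) :
    (biprod.fst (X := M) (Y := N)).hom ((biprod.lift f g).hom x) = f.hom x :=
  LinearMap.congr_fun (congrArg ModuleCat.Hom.hom (biprod.lift_fst f g)) x

lemma biprod_lift_snd_apply {M N L : ModuleCat.{u} A} (f : L ⟶ M) (g : L ⟶ N) (x : L) :
    (biprod.snd (X := M) (Y := N)).hom ((biprod.lift f g).hom x) = g.hom x :=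
  LinearMap.congr_fun (congrArg ModuleCat.Hom.hom (biprod.lift_snd f g)) x

lemma biprod_ext {M N : ModuleCat.{u} A} {x y : (M ⊞ N : ModuleCat.{u} A)}
    (h₁ : (biprod.fst (X := M) (Y := N)).hom x = (biprod.fst (X := M) (Y := N)).hom y)
    (h₂ : (biprod.snd (X := M) (Y := N)).hom x = (biprod.snd (X := M) (Y := N)).hom y) :
    x = y := by
  have h (z : (M ⊞ N : ModuleCat.{u} A)) :
      (biprod.inl (X := M) (Y := N)).hom ((biprod.fst (X := M) (Y := N)).hom z) +
        (biprod.inr (X := M) (Y := N)).hom ((biprod.snd (X := M) (Y := N)).hom z) = z :=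
    LinearMap.congr_fun (congrArg ModuleCat.Hom.hom (biprod.total (X := M) (Y := N))) z
  rw [← h x, ← h y, h₁, h₂]

lemma exists_biprod {M N : ModuleCat.{u} A} (m : M) (n : N) :
    ∃ x : (M ⊞ N : ModuleCat.{u} A), (biprod.fst (X := M) (Y := N)).hom x = m ∧
      (biprod.snd (X := M) (Y := N)).hom x = n := by
  refine ⟨(biprod.inl (X := M) (Y := N)).hom m + (biprod.inr (X := M) (Y := N)).hom n, ?_, ?_⟩
  · have h₁ := LinearMap.congr_fun (congrArg ModuleCat.Hom.hom
      (biprod.inl_fst (X := M) (Y := N))) m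
    have h₂ := LinearMap.congr_fun (congrArg ModuleCat.Hom.hom
      (biprod.inr_fst (X := M) (Y := N))) n
    rw [map_add]
    exact (congrArg₂ _ h₁ h₂).trans (add_zero _)
  · have h₁ := LinearMap.congr_fun (congrArg ModuleCat.Hom.hom
      (biprod.inl_snd (X := M) (Y := N))) m
    have h₂ := LinearMap.congr_fun (congrArg ModuleCat.Hom.hom
      (biprod.inr_snd (X := M) (Y := N))) n
    rw [map_add]
    exact (congrArg₂ _ h₁ h₂).trans (zero_add _)

end BiprodElements

/-! ### Elements of mapping cones -/

section Cone

open CochainComplex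

variable {A : Type u} [Ring A] {Y Z : KProj A} (g : cpx Y ⟶ cpx Z)

/-- The first component of an element of the mapping cone. -/
def coneFst (i : ℤ) : (cpx (coneObj g)).X i ⟶ (cpx Y).X (i + 1) :=
  (mappingCone.fst g).1.v i (i + 1) rfl

/-- The second component of an element of the mapping cone. -/
def coneSnd (i : ℤ) : (cpx (coneObj g)).X i ⟶ (cpx Z).X i :=
  (mappingCone.snd g).v i i (add_zero i)

/-- The inclusion of the first component into the mapping cone. -/
def coneInl (i : ℤ) : (cpx Y).X (i + 1) ⟶ (cpx (coneObj g)).X i :=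
  (mappingCone.inl g).v (i + 1) i (by lia)

/-- The inclusion of the second component into the mapping cone. -/
def coneInr (i : ℤ) : (cpx Z).X i ⟶ (cpx (coneObj g)).X i :=
  (mappingCone.inr g).f i

lemma coneInl_add_coneInr (i : ℤ) (x : (cpx (coneObj g)).X i) :
    (coneInl g i).hom ((coneFst g i).hom x) + (coneInr g i).hom ((coneSnd g i).hom x) = x :=
  LinearMap.congr_fun (congrArg ModuleCat.Hom.hom (mappingCone.id_X g i (i + 1) rfl)) x

lemma cone_ext {i : ℤ} {x y : (cpx (coneObj g)).X i}
    (h₁ : (coneFst g i).hom x = (coneFst g i).hom y)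
    (h₂ : (coneSnd g i).hom x = (coneSnd g i).hom y) : x = y := by
  rw [← coneInl_add_coneInr g i x, ← coneInl_add_coneInr g i y, h₁, h₂]

lemma coneFst_coneInl (i : ℤ) (y : (cpx Y).X (i + 1)) :
    (coneFst g i).hom ((coneInl g i).hom y) = y :=
  LinearMap.congr_fun (congrArg ModuleCat.Hom.hom (mappingCone.inl_v_fst_v g (i + 1) i rfl)) y

lemma coneFst_coneInr (i : ℤ) (z : (cpx Z).X i) :
    (coneFst g i).hom ((coneInr g i).hom z) = 0 :=
  LinearMap.congr_fun (congrArg ModuleCat.Hom.hom (mappingCone.inr_f_fst_v g i (i + 1) rfl)) z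

lemma coneSnd_coneInl (i : ℤ) (y : (cpx Y).X (i + 1)) :
    (coneSnd g i).hom ((coneInl g i).hom y) = 0 :=
  LinearMap.congr_fun (congrArg ModuleCat.Hom.hom
    (mappingCone.inl_v_snd_v g (i + 1) i (by lia))) y

lemma coneSnd_coneInr (i : ℤ) (z : (cpx Z).X i) :
    (coneSnd g i).hom ((coneInr g i).hom z) = z :=
  LinearMap.congr_fun (congrArg ModuleCat.Hom.hom (mappingCone.inr_f_snd_v g i)) z

lemma coneFst_d (i j : ℤ) (hij : i + 1 = j) (x : (cpx (coneObj g)).X i) :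
    (coneFst g j).hom (((cpx (coneObj g)).d i j).hom x) =
      -((cpx Y).d (i + 1) (j + 1)).hom ((coneFst g i).hom x) := by
  obtain rfl := hij
  exact LinearMap.congr_fun (congrArg ModuleCat.Hom.hom
    (mappingCone.d_fst_v g i (i + 1) (i + 1 + 1) rfl rfl)) x

lemma coneSnd_d (i : ℤ) (x : (cpx (coneObj g)).X i) :
    (coneSnd g (i + 1)).hom (((cpx (coneObj g)).d i (i + 1)).hom x) =
      (g.f (i + 1)).hom ((coneFst g i).hom x) +
        ((cpx Z).d i (i + 1)).hom ((coneSnd g i).hom x) :=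
  LinearMap.congr_fun (congrArg ModuleCat.Hom.hom (mappingCone.d_snd_v g i (i + 1) rfl)) x

lemma coneSnd_d' {i j : ℤ} (hij : i + 1 = j) (x : (cpx (coneObj g)).X i) :
    (coneSnd g j).hom (((cpx (coneObj g)).d i j).hom x) =
      (g.f j).hom (((cpx Y).XIsoOfEq hij).hom.hom ((coneFst g i).hom x)) +
        ((cpx Z).d i j).hom ((coneSnd g i).hom x) := by
  subst hij
  exact coneSnd_d g i x

/-- The element is the pair `(y, z)`. Indexing `y` by `j` instead of `i + 1` lets this apply at `i =
j - 1` without transport. -/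
lemma exists_cone {i j : ℤ} (hij : i + 1 = j) (y : (cpx Y).X j) (z : (cpx Z).X i) :
    ∃ x : (cpx (coneObj g)).X i,
      (coneFst g j).hom (((cpx (coneObj g)).d i j).hom x) = -((cpx Y).d j (j + 1)).hom y ∧
      (coneSnd g j).hom (((cpx (coneObj g)).d i j).hom x) =
        (g.f j).hom y + ((cpx Z).d i j).hom z := by
  subst hij
  refine ⟨(coneInl g i).hom y + (coneInr g i).hom z, ?_, ?_⟩
  · rw [coneFst_d g i (i + 1) rfl, map_add, coneFst_coneInl, coneFst_coneInr, add_zero]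
  · rw [coneSnd_d, map_add, coneFst_coneInl, coneFst_coneInr, add_zero, map_add,
      coneSnd_coneInl, coneSnd_coneInr, zero_add]

end Cone

/-! ### Two exact sequences for `Cⁱ` of a cone -/

section ConeSequences

variable {A : Type u} [Ring A] {Y Z : KProj A} (g : cpx Y ⟶ cpx Z) (i : ℤ)

lemma d_coneFst_cokπ :
    (cpx (coneObj g)).d (i - 1) i ≫ coneFst g i ≫ cokπ Y (i + 1) = 0 := by
  ext x
  change (cokπ Y (i + 1)).hom ((coneFst g i).hom (((cpx (coneObj g)).d (i - 1) i).hom x)) = 0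
  rw [coneFst_d g (i - 1) i (by lia), map_neg,
    (exact_d_cokπ Y (by lia)).apply_apply_eq_zero, neg_zero]

/-- The map `Cⁱ(cone g) → Cⁱ⁺¹(Y) ⊞ Zⁱ⁺¹` for `g : Y → Z`. -/
def cokConeToBiprod : cok (coneObj g) i ⟶ cok Y (i + 1) ⊞ (cpx Z).X (i + 1) :=
  biprod.lift (cokDesc (coneObj g) i (coneFst g i ≫ cokπ Y (i + 1)) (d_coneFst_cokπ g i))
    (cokDesc (coneObj g) i ((cpx (coneObj g)).d i (i + 1) ≫ coneSnd g (i + 1)) (by simp))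

lemma cokConeToBiprod_fst (x : (cpx (coneObj g)).X i) :
    (biprod.fst (X := cok Y (i + 1)) (Y := (cpx Z).X (i + 1))).hom
      ((cokConeToBiprod g i).hom ((cokπ (coneObj g) i).hom x)) =
        (cokπ Y (i + 1)).hom ((coneFst g i).hom x) :=
  (biprod_lift_fst_apply _ _ _).trans (cokDesc_apply _ _ _ _ _)

lemma cokConeToBiprod_snd (x : (cpx (coneObj g)).X i) :
    (biprod.snd (X := cok Y (i + 1)) (Y := (cpx Z).X (i + 1))).hom
      ((cokConeToBiprod g i).hom ((cokπ (coneObj g) i).hom x)) =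
        (g.f (i + 1)).hom ((coneFst g i).hom x) +
          ((cpx Z).d i (i + 1)).hom ((coneSnd g i).hom x) :=
  (biprod_lift_snd_apply _ _ _).trans ((cokDesc_apply _ _ _ _ _).trans (coneSnd_d g i x))

/-- The map `Cⁱ⁺¹(Y) ⊞ Zⁱ⁺¹ → Cⁱ⁺¹(Z)` for `g : Y → Z`. -/
def biprodToCok : cok Y (i + 1) ⊞ (cpx Z).X (i + 1) ⟶ cok Z (i + 1) :=
  biprod.desc (cokMap g (i + 1)) (-cokπ Z (i + 1))

lemma biprodToCok_apply (w : (cok Y (i + 1) ⊞ (cpx Z).X (i + 1) : ModuleCat.{u} A)) :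
    (biprodToCok g i).hom w =
      (cokMap g (i + 1)).hom ((biprod.fst (X := cok Y (i + 1)) (Y := (cpx Z).X (i + 1))).hom w) -
        (cokπ Z (i + 1)).hom ((biprod.snd (X := cok Y (i + 1)) (Y := (cpx Z).X (i + 1))).hom w) :=
  (biprod_desc_apply _ _ _).trans (sub_eq_add_neg _ _).symm

lemma cokConeToBiprod_comp_biprodToCok : cokConeToBiprod g i ≫ biprodToCok g i = 0 := by
  apply cok_hom_ext
  ext x
  change (biprodToCok g i).hom ((cokConeToBiprod g i).hom ((cokπ (coneObj g) i).hom x)) = 0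
  rw [biprodToCok_apply, cokConeToBiprod_fst, cokConeToBiprod_snd, cokMap_apply, map_add,
    (exact_d_cokπ Z rfl).apply_apply_eq_zero]
  abel

/-- Cohomological surjectivity enters only in the injectivity. If `(y, z)` maps to zero, then `y = d
y'` and `g y' + z` is a cocycle. Write it as `g y'' + d z'` with `y''` a cocycle; then `(y, z)` is
the boundary of `(y'' - y', z')`. -/
lemma cokCone_shortExact (hg : SurjectiveOnCohomologyAt g i) :
    (ShortComplex.mk (cokConeToBiprod g i) (biprodToCok g i)
      (cokConeToBiprod_comp_biprodToCok g i)).ShortExact := by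
  have hinj : Function.Injective (cokConeToBiprod g i).hom := by
    rw [injective_iff_map_eq_zero]
    intro c hc
    obtain ⟨x, rfl⟩ := cokπ_surjective (coneObj g) i c
    have h₁ := cokConeToBiprod_fst g i x
    have h₂ := cokConeToBiprod_snd g i x
    rw [hc, map_zero] at h₁ h₂
    obtain ⟨y', hy'⟩ := (exact_d_cokπ Y (show i + 1 = i + 1 from rfl) _).1 h₁.symm
    have h3 : ((cpx Z).d i (i + 1)).hom ((g.f i).hom y' + (coneSnd g i).hom x) = 0 := by
      rw [map_add, chainMap_apply, hy', ← h₂]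
    obtain ⟨y'', hy'', z, hz⟩ := hg _ h3
    obtain ⟨w, hw₁, hw₂⟩ := exists_cone g (sub_add_cancel i 1) (y'' - y') z
    refine (exact_d_cokπ (coneObj g) (sub_add_cancel i 1) _).2 ⟨w, cone_ext g ?_ ?_⟩
    · rw [hw₁, map_sub, hy'', zero_sub, neg_neg, hy']
    · rw [hw₂, map_sub, sub_add_eq_add_sub, ← hz]
      abel
  have hex : Function.Exact (cokConeToBiprod g i).hom (biprodToCok g i).hom := by
    intro w
    constructor
    · intro hw
      rw [biprodToCok_apply, sub_eq_zero] at hw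
      obtain ⟨y, hy⟩ := cokπ_surjective Y (i + 1)
        ((biprod.fst (X := cok Y (i + 1)) (Y := (cpx Z).X (i + 1))).hom w)
      rw [← hy, cokMap_apply, ← sub_eq_zero, ← map_sub] at hw
      obtain ⟨z, hz⟩ := (exact_d_cokπ Z (show i + 1 = i + 1 from rfl) _).1 hw
      refine ⟨(cokπ (coneObj g) i).hom ((coneInl g i).hom y + (coneInr g i).hom (-z)),
        biprod_ext ?_ ?_⟩
      · rw [cokConeToBiprod_fst, map_add, coneFst_coneInl, coneFst_coneInr, add_zero, hy]
      · rw [cokConeToBiprod_snd, map_add, coneFst_coneInl, coneFst_coneInr, add_zero, map_add,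
          coneSnd_coneInl, coneSnd_coneInr, zero_add, map_neg, hz]
        abel
    · rintro ⟨x, rfl⟩
      exact LinearMap.congr_fun (congrArg ModuleCat.Hom.hom
        (cokConeToBiprod_comp_biprodToCok g i)) x
  have hsurj : Function.Surjective (biprodToCok g i).hom := by
    intro c
    obtain ⟨z, rfl⟩ := cokπ_surjective Z (i + 1) c
    obtain ⟨w, hw₁, hw₂⟩ := exists_biprod (M := cok Y (i + 1)) (N := (cpx Z).X (i + 1)) 0 (-z)
    refine ⟨w, ?_⟩
    rw [biprodToCok_apply, hw₁, hw₂, map_zero, map_neg, zero_sub, neg_neg]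
  exact shortExact_of_maps hinj hex hsurj

/-- The map `Cⁱ(Y) → Cⁱ(Z) ⊞ Yⁱ⁺¹` for `g : Y → Z`. -/
def cokToBiprod : cok Y i ⟶ cok Z i ⊞ (cpx Y).X (i + 1) :=
  biprod.lift (cokMap g i) (cokDesc Y i (-(cpx Y).d i (i + 1)) (by simp))

lemma cokToBiprod_fst (y : (cpx Y).X i) :
    (biprod.fst (X := cok Z i) (Y := (cpx Y).X (i + 1))).hom
      ((cokToBiprod g i).hom ((cokπ Y i).hom y)) = (cokπ Z i).hom ((g.f i).hom y) :=
  (biprod_lift_fst_apply _ _ _).trans (cokMap_apply _ _ _)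

lemma cokToBiprod_snd (y : (cpx Y).X i) :
    (biprod.snd (X := cok Z i) (Y := (cpx Y).X (i + 1))).hom
      ((cokToBiprod g i).hom ((cokπ Y i).hom y)) = -((cpx Y).d i (i + 1)).hom y :=
  (biprod_lift_snd_apply _ _ _).trans (cokDesc_apply _ _ _ _ _)

lemma d_coneInr_cokπ :
    (cpx Z).d (i - 1) i ≫ coneInr g i ≫ cokπ (coneObj g) i = 0 := by
  have : (cpx Z).d (i - 1) i ≫ coneInr g i =
      coneInr g (i - 1) ≫ (cpx (coneObj g)).d (i - 1) i :=
    ((CochainComplex.mappingCone.inr g).comm (i - 1) i).symm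
  rw [← Category.assoc, this, Category.assoc, d_cokπ, comp_zero]

/-- The map `Cⁱ(Z) ⊞ Yⁱ⁺¹ → Cⁱ(cone g)` for `g : Y → Z`. -/
def biprodToCokCone : cok Z i ⊞ (cpx Y).X (i + 1) ⟶ cok (coneObj g) i :=
  biprod.desc (cokDesc Z i (coneInr g i ≫ cokπ (coneObj g) i) (d_coneInr_cokπ g i))
    (coneInl g i ≫ cokπ (coneObj g) i)

lemma biprodToCokCone_apply (w : (cok Z i ⊞ (cpx Y).X (i + 1) : ModuleCat.{u} A))
    (z : (cpx Z).X i)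
    (hz : (biprod.fst (X := cok Z i) (Y := (cpx Y).X (i + 1))).hom w = (cokπ Z i).hom z) :
    (biprodToCokCone g i).hom w = (cokπ (coneObj g) i).hom ((coneInl g i).hom
      ((biprod.snd (X := cok Z i) (Y := (cpx Y).X (i + 1))).hom w) + (coneInr g i).hom z) := by
  refine (biprod_desc_apply _ _ _).trans ?_
  rw [hz, cokDesc_apply, map_add, add_comm]
  rfl

/-- `Cⁱ(cone g)` is `Yⁱ⁺¹ ⊕ Zⁱ` modulo the pairs `(-d y, g y + d z)`. Dividing by the `d z` first
leaves the image of `Cⁱ(Y)`. This needs no assumption on `g`, but the first map need not be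
injective. -/
lemma exact_cokToBiprod_biprodToCokCone :
    Function.Exact (cokToBiprod g i).hom (biprodToCokCone g i).hom := by
  intro w
  obtain ⟨z, hz⟩ := cokπ_surjective Z i
    ((biprod.fst (X := cok Z i) (Y := (cpx Y).X (i + 1))).hom w)
  rw [biprodToCokCone_apply g i w z hz.symm, exact_d_cokπ (coneObj g) (sub_add_cancel i 1) _]
  constructor
  · rintro ⟨x, hx⟩
    have h₁ := congrArg (coneFst g i).hom hx
    have h₂ := congrArg (coneSnd g i).hom hx
    rw [coneFst_d g (i - 1) i (sub_add_cancel i 1), map_add, coneFst_coneInl, coneFst_coneInr,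
      add_zero] at h₁
    rw [coneSnd_d' g (sub_add_cancel i 1), map_add, coneSnd_coneInl, coneSnd_coneInr,
      zero_add] at h₂
    -- The first component of `x` lies in degree `i - 1 + 1`, which has to be transported to `i`.
    have e (j : ℤ) (hj : j = i) (v : (cpx Y).X j) :
        ((cpx Y).d i (i + 1)).hom (((cpx Y).XIsoOfEq hj).hom.hom v) =
          ((cpx Y).d j (i + 1)).hom v := by
      subst hj
      rfl
    refine ⟨(cokπ Y i).hom
      (((cpx Y).XIsoOfEq (sub_add_cancel i 1)).hom.hom ((coneFst g (i - 1)).hom x)),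
      biprod_ext ?_ ?_⟩
    · rw [cokToBiprod_fst, ← hz, ← h₂, map_add,
        (exact_d_cokπ Z (sub_add_cancel i 1)).apply_apply_eq_zero, add_zero]
    · rw [cokToBiprod_snd, e, h₁]
  · rintro ⟨c, rfl⟩
    obtain ⟨y, rfl⟩ := cokπ_surjective Y i c
    rw [cokToBiprod_fst, ← sub_eq_zero, ← map_sub] at hz
    obtain ⟨z', hz'⟩ := (exact_d_cokπ Z (sub_add_cancel i 1) _).1 hz
    obtain ⟨x, hx₁, hx₂⟩ := exists_cone g (sub_add_cancel i 1) y z'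
    refine ⟨x, cone_ext g ?_ ?_⟩
    · rw [hx₁, map_add, coneFst_coneInl, coneFst_coneInr, add_zero, cokToBiprod_snd]
    · rw [hx₂, map_add, coneSnd_coneInl, coneSnd_coneInr, zero_add, hz']
      abel

lemma biprodToCokCone_surjective : Function.Surjective (biprodToCokCone g i).hom := by
  intro c
  obtain ⟨x, rfl⟩ := cokπ_surjective (coneObj g) i c
  obtain ⟨w, hw₁, hw₂⟩ := exists_biprod (M := cok Z i) (N := (cpx Y).X (i + 1))
    ((cokπ Z i).hom ((coneSnd g i).hom x)) ((coneFst g i).hom x)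
  exact ⟨w, by rw [biprodToCokCone_apply g i w _ hw₁, hw₂, coneInl_add_coneInr]⟩

end ConeSequences

/-! ### Maps from and to stalk complexes -/

section Stalk

variable {A : Type u} [Ring A]

variable (A) in
/-- The regular module, viewed as a complex concentrated in degree `k`. -/
def stalk (k : ℤ) : KProj A where
  obj := (HomotopyCategory.quotient _ _).obj
    ((HomologicalComplex.single (ModuleCat.{u} A) (ComplexShape.up ℤ) k).obj (ModuleCat.of A A))
  property i := by
    by_cases hi : i = k
    · subst hi
      exact IsFGProj.of_iso IsFGProj.self
        (HomologicalComplex.singleObjXSelf (ComplexShape.up ℤ) i (ModuleCat.of A A))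
    · exact IsFGProj.of_isZero
        (HomologicalComplex.isZero_single_obj_X (ComplexShape.up ℤ) k (ModuleCat.of A A) i hi)

variable (A) in
lemma nonempty_unitComplex_shift_iso_stalk (k : ℤ) :
    Nonempty ((unitComplex A)⟦-k⟧ ≅ stalk A k) :=
  ⟨ObjectProperty.isoMk _ (((projComplexes A).ι.commShiftIso (-k)).app (unitComplex A) ≪≫
    ((HomotopyCategory.singleFunctors (ModuleCat.{u} A)).shiftIso (-k) k 0 (by lia)).app
      (ModuleCat.of A A))⟩

lemma isAdd_stalk (k : ℤ) : IsAdd (stalk A k) := by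
  intro Q h₀ hs hr _
  obtain ⟨e⟩ := nonempty_unitComplex_shift_iso_stalk A k
  exact hr _ _ ⟨Retract.ofIso e.symm⟩ (hs _ _ h₀)

/-- The isomorphism of the degree `k` term of `stalk A k` with `A`. -/
def stalkXIso (k : ℤ) : (cpx (stalk A k)).X k ≅ ModuleCat.of A A :=
  HomologicalComplex.singleObjXSelf (ComplexShape.up ℤ) k (ModuleCat.of A A)

/-- The canonical generator of `stalk A k`. -/
def stalkGen (k : ℤ) : (cpx (stalk A k)).X k :=
  (stalkXIso k).inv.hom (1 : A)

lemma stalkXIso_stalkGen (k : ℤ) : (stalkXIso k).hom.hom (stalkGen k) = (1 : A) :=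
  LinearMap.congr_fun (congrArg ModuleCat.Hom.hom (stalkXIso (A := A) k).inv_hom_id) (1 : A)

lemma stalk_d (k i j : ℤ) : (cpx (stalk A k)).d i j = 0 :=
  HomologicalComplex.single_obj_d _ _ _ _ _

lemma exists_chainMap_from_stalk {Y : KProj A} (k : ℤ) (y : (cpx Y).X k)
    (hy : ((cpx Y).d k (k + 1)).hom y = 0) :
    ∃ f : cpx (stalk A k) ⟶ cpx Y, (f.f k).hom (stalkGen k) = y := by
  let φ : ModuleCat.of A A ⟶ (cpx Y).X k := ModuleCat.ofHom (LinearMap.toSpanSingleton A _ y)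
  have hφ : φ.hom (1 : A) = y := LinearMap.toSpanSingleton_apply_one A _ y
  refine ⟨HomologicalComplex.mkHomFromSingle φ ?_, ?_⟩
  · rintro _ rfl
    ext
    change ((cpx Y).d k (k + 1)).hom (φ.hom (1 : A)) = 0
    rw [hφ, hy]
  · have := LinearMap.congr_fun (congrArg ModuleCat.Hom.hom (HomologicalComplex.mkHomFromSingle_f
      (c := ComplexShape.up ℤ) φ (by
        rintro _ rfl
        ext
        change ((cpx Y).d k (k + 1)).hom (φ.hom (1 : A)) = 0
        rw [hφ, hy]))) (stalkGen k)
    refine this.trans ?_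
    change φ.hom ((stalkXIso k).hom.hom (stalkGen k)) = y
    rw [stalkXIso_stalkGen, hφ]

lemma ofChainMap_eq_from_stalk {Y : KProj A} (k : ℤ) (f g : cpx (stalk A k) ⟶ cpx Y)
    (y : (cpx Y).X (k - 1)) (hy : (f.f k).hom (stalkGen k) =
      ((cpx Y).d (k - 1) k).hom y + (g.f k).hom (stalkGen k)) :
    ofChainMap f = ofChainMap g := by
  let φ : ModuleCat.of A A ⟶ (cpx Y).X (k - 1) :=
    ModuleCat.ofHom (LinearMap.toSpanSingleton A _ y)
  have hφ : φ.hom (1 : A) = y := LinearMap.toSpanSingleton_apply_one A _ y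
  -- The homotopy is the degree `-1` cochain sending the generator to `y`; its coboundary is the
  -- generator's image `d y`.
  let γ : CochainComplex.HomComplex.Cochain (cpx (stalk A k)) (cpx Y) (-1) :=
    CochainComplex.HomComplex.Cochain.fromSingleMk φ (show k + (-1) = k - 1 by lia)
  have hγ : CochainComplex.HomComplex.δ (-1) 0 γ =
      CochainComplex.HomComplex.Cochain.fromSingleMk (φ ≫ (cpx Y).d (k - 1) k) (add_zero k) :=
    CochainComplex.HomComplex.Cochain.δ_fromSingleMk φ _ _ _ _
  refine ofChainMap_eq_of_homotopy ((CochainComplex.HomComplex.Cochain.equivHomotopy f g).symm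
    ⟨γ, ?_⟩)
  apply (CochainComplex.HomComplex.Cochain.fromSingleEquiv (X := ModuleCat.of A A)
    (K := cpx Y) (add_zero k)).injective
  have h₁ (u : cpx (stalk A k) ⟶ cpx Y) :
      CochainComplex.HomComplex.Cochain.fromSingleEquiv (X := ModuleCat.of A A) (K := cpx Y)
        (add_zero k) (CochainComplex.HomComplex.Cochain.ofHom u) =
          (stalkXIso k).inv ≫ u.f k := by
    simp [CochainComplex.HomComplex.Cochain.fromSingleEquiv]
    rfl
  have h₂ : CochainComplex.HomComplex.Cochain.fromSingleEquiv (X := ModuleCat.of A A)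
      (K := cpx Y) (add_zero k) (CochainComplex.HomComplex.δ (-1) 0 γ) =
        φ ≫ (cpx Y).d (k - 1) k :=
    (congrArg _ hγ).trans
      (CochainComplex.HomComplex.Cochain.fromSingleEquiv_fromSingleMk _ _)
  refine (h₁ f).trans (Eq.trans ?_ ((map_add _ _ _).trans (congrArg₂ _ h₂ (h₁ g))).symm)
  ext
  refine hy.trans (congrArg₂ _ ?_ rfl)
  exact congrArg _ hφ.symm

/-- Homotopy classes of maps from the stalk in degree `k` to `Y` are the elements of `Hᵏ(Y)`,
through the image of the generator. -/
lemma surjectiveOnCohomologyAt_of_lift {X Y : KProj A} (f : cpx X ⟶ cpx Y) (k : ℤ)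
    (h : ∀ w : stalk A k ⟶ Y, ∃ t : stalk A k ⟶ X, t ≫ ofChainMap f = w) :
    SurjectiveOnCohomologyAt f k := by
  intro z hz
  obtain ⟨w, hw⟩ := exists_chainMap_from_stalk k z hz
  obtain ⟨t, ht⟩ := h (ofChainMap w)
  obtain ⟨t, rfl⟩ := ofChainMap_surjective t
  rw [ofChainMap_comp] at ht
  obtain ⟨H⟩ := nonempty_homotopy_of_eq ht
  have h1 := homotopy_apply H (sub_add_cancel k 1) rfl (stalkGen k)
  have h2 : ((cpx (stalk A k)).d k (k + 1)).hom (stalkGen k) = 0 := by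
    rw [stalk_d]
    rfl
  rw [hw, h2, map_zero, zero_add] at h1
  refine ⟨(t.f k).hom (stalkGen k), ?_, -(H.hom k (k - 1)).hom (stalkGen k), ?_⟩
  · rw [chainMap_apply, h2, map_zero]
  · rw [map_neg]
    change (f.f k).hom ((t.f k).hom (stalkGen k)) = _ at h1
    rw [h1]
    abel

lemma exists_lift_of_surjectiveOnCohomologyAt {X Y : KProj A} (f : cpx X ⟶ cpx Y) (k : ℤ)
    (h : SurjectiveOnCohomologyAt f k) (w : stalk A k ⟶ Y) :
    ∃ t : stalk A k ⟶ X, t ≫ ofChainMap f = w := by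
  obtain ⟨w, rfl⟩ := ofChainMap_surjective w
  have h2 : ((cpx (stalk A k)).d k (k + 1)).hom (stalkGen k) = 0 := by
    rw [stalk_d]
    rfl
  obtain ⟨x, hx, y, hy⟩ := h ((w.f k).hom (stalkGen k)) (by rw [chainMap_apply, h2, map_zero])
  obtain ⟨t, rfl⟩ := exists_chainMap_from_stalk k x hx
  refine ⟨ofChainMap t, ?_⟩
  rw [ofChainMap_comp]
  refine (ofChainMap_eq_from_stalk k _ _ y ?_).symm
  rw [hy, add_comm]
  rfl

lemma exists_chainMap_to_stalk {Y : KProj A} (k : ℤ) (φ : (cpx Y).X k →ₗ[A] A)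
    (hφ : ∀ y : (cpx Y).X (k - 1), φ (((cpx Y).d (k - 1) k).hom y) = 0) :
    ∃ f : cpx Y ⟶ cpx (stalk A k), (f.f k ≫ (stalkXIso k).hom).hom = φ := by
  have h : ∀ i, (ComplexShape.up ℤ).Rel i k →
      (cpx Y).d i k ≫ ModuleCat.ofHom (Y := A) φ = 0 := by
    intro i hi
    obtain rfl : i = k - 1 := by
      change i + 1 = k at hi
      lia
    ext y
    exact hφ y
  refine ⟨HomologicalComplex.mkHomToSingle (ModuleCat.ofHom φ) h, ?_⟩
  have : (HomologicalComplex.mkHomToSingle (ModuleCat.ofHom φ) h).f k ≫ (stalkXIso k).hom =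
      ModuleCat.ofHom φ := by
    refine (congrArg (· ≫ (stalkXIso k).hom)
      (HomologicalComplex.mkHomToSingle_f (ModuleCat.ofHom φ) h)).trans ?_
    refine (Category.assoc _ _ _).trans ?_
    exact (congrArg _ (stalkXIso k).inv_hom_id).trans (Category.comp_id _)
  exact congrArg ModuleCat.Hom.hom this

/-- Chain maps from `X` to the stalk in degree `k` are functionals on `Cᵏ(X)`, and null-homotopic
ones factor through `d : Xᵏ → Xᵏ⁺¹`. Lifting through the approximation up to homotopy therefore
gives the two terms `ψ` and `h`. -/
lemma exists_factorization_of_isLeftAddApprox {X Q : KProj A} (q : cpx X ⟶ cpx Q)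
    (hq : IsLeftAddApprox (ofChainMap q)) (k : ℤ) (φ : (cpx X).X k →ₗ[A] A)
    (hφ : ∀ y : (cpx X).X (k - 1), φ (((cpx X).d (k - 1) k).hom y) = 0) :
    ∃ (ψ : (cpx Q).X k →ₗ[A] A) (h : (cpx X).X (k + 1) →ₗ[A] A),
      (∀ y : (cpx Q).X (k - 1), ψ (((cpx Q).d (k - 1) k).hom y) = 0) ∧
      ∀ x, φ x = ψ ((q.f k).hom x) + h (((cpx X).d k (k + 1)).hom x) := by
  obtain ⟨w, hw⟩ := exists_chainMap_to_stalk k φ hφ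
  obtain ⟨t, ht⟩ := hq.2 _ (isAdd_stalk k) (ofChainMap w)
  obtain ⟨t, rfl⟩ := ofChainMap_surjective t
  rw [ofChainMap_comp] at ht
  obtain ⟨H⟩ := nonempty_homotopy_of_eq ht.symm
  refine ⟨(t.f k ≫ (stalkXIso k).hom).hom, (H.hom (k + 1) k ≫ (stalkXIso k).hom).hom,
    fun y => ?_, fun x => ?_⟩
  · change (stalkXIso k).hom.hom ((t.f k).hom (((cpx Q).d (k - 1) k).hom y)) = 0
    rw [← chainMap_apply, stalk_d]
    exact map_zero _
  · have h1 := homotopy_apply H (sub_add_cancel k 1) rfl x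
    have h2 : ((cpx (stalk A k)).d (k - 1) k).hom ((H.hom k (k - 1)).hom x) = 0 := by
      rw [stalk_d]
      rfl
    rw [h2, add_zero] at h1
    rw [← hw]
    change (stalkXIso k).hom.hom ((w.f k).hom x) = _
    rw [h1, map_add, add_comm]
    rfl

end Stalk

/-! ### Split complexes -/

section Split

variable {A : Type u} [Ring A]

/-- The endomorphism `1 - d s` of `Xⁱ` kills the image of `d`, so it descends to a section of `Xⁱ →
Cⁱ(X)`. -/
lemma IsSplitComplex.isFGProj_cok {X : KProj A} (hX : IsSplitComplex X) (i : ℤ) :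
    IsFGProj (cok X i) := by
  obtain ⟨s, hs⟩ := hX
  obtain ⟨j, rfl⟩ : ∃ j, i = j + 1 := ⟨i - 1, by lia⟩
  have hd : (cpx X).d j (j + 1) ≫ cokπ X (j + 1) = 0 := by
    ext x
    exact (exact_d_cokπ X rfl).apply_apply_eq_zero x
  have h : ∀ k, k = j →
      (cpx X).d k (j + 1) ≫ (𝟙 _ - s j ≫ (cpx X).d j (j + 1)) = 0 := by
    rintro _ rfl
    rw [Preadditive.comp_sub, hs, Category.comp_id, sub_self]
  refine (X.property (j + 1)).of_retract
    (cokDesc X (j + 1) (𝟙 _ - s j ≫ (cpx X).d j (j + 1)) (h _ (by lia))) (cokπ X (j + 1)) ?_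
  apply cok_hom_ext
  rw [← Category.assoc, cokπ_cokDesc, Preadditive.sub_comp, Category.assoc, hd, comp_zero,
    sub_zero, Category.id_comp, Category.comp_id]

/-- When `Xⁱ⁺¹ → Cⁱ⁺¹` splits, there is a projection `ρ` of `Xⁱ⁺¹` onto the image of `d`; lifting
`ρ` through `Xⁱ ↠ im d` gives `s`. -/
lemma isSplitComplex_of_projective_cok {X : KProj A} (hX : ∀ i, Projective (cok X i)) :
    IsSplitComplex X := by
  have key (i : ℤ) : ∃ s : (cpx X).X (i + 1) ⟶ (cpx X).X i,
      (cpx X).d i (i + 1) ≫ s ≫ (cpx X).d i (i + 1) = (cpx X).d i (i + 1) := by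
    have := hX (i + 1)
    have : Epi (cokπ X (i + 1)) := (ModuleCat.epi_iff_surjective _).2 (cokπ_surjective X _)
    let σ := Projective.factorThru (𝟙 (cok X (i + 1))) (cokπ X (i + 1))
    have hσ (c : cok X (i + 1)) : (cokπ X (i + 1)).hom (σ.hom c) = c :=
      LinearMap.congr_fun (congrArg ModuleCat.Hom.hom
        (Projective.factorThru_comp (𝟙 (cok X (i + 1))) (cokπ X (i + 1)))) c
    let ρ : (cpx X).X (i + 1) →ₗ[A] LinearMap.range ((cpx X).d i (i + 1)).hom :=
      (LinearMap.id - σ.hom ∘ₗ (cokπ X (i + 1)).hom).codRestrict _ fun x => by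
        refine (exact_d_cokπ X rfl _).1 ?_
        change (cokπ X (i + 1)).hom (x - σ.hom ((cokπ X (i + 1)).hom x)) = 0
        rw [map_sub, hσ, sub_self]
    have := (X.property (i + 1)).2
    obtain ⟨s, hs⟩ := Module.projective_lifting_property
      ((cpx X).d i (i + 1)).hom.rangeRestrict ρ (LinearMap.surjective_rangeRestrict _)
    refine ⟨ModuleCat.ofHom s, ?_⟩
    ext x
    have h1 := congrArg Subtype.val (LinearMap.congr_fun hs (((cpx X).d i (i + 1)).hom x))
    refine h1.trans ?_
    change ((cpx X).d i (i + 1)).hom x -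
      σ.hom ((cokπ X (i + 1)).hom (((cpx X).d i (i + 1)).hom x)) = _
    rw [(exact_d_cokπ X rfl).apply_apply_eq_zero, map_zero, sub_zero]
  choose s hs using key
  exact ⟨s, hs⟩

lemma isStableProperty_isFGProj : IsStableProperty (IsFGProj (A := A)) where
  of_retract r h := h.of_retract r.i r.r r.retract
  biprod h h' := h.biprod h'

/-- Every object receives a cohomologically surjective map from a complex with zero differential. -/
lemma exists_split_cover [IsNoetherianRing A] (X : KProj A) :
    ∃ (P : KProj A) (f : cpx P ⟶ cpx X), IsSplitComplex P ∧
      ∀ j, SurjectiveOnCohomologyAt f j := by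
  -- A finite free cover of the cocycles in each degree; these are finitely generated because the
  -- ring is noetherian.
  have key (i : ℤ) : ∃ (n : ℕ) (f : (Fin n → A) →ₗ[A] (cpx X).X i),
      LinearMap.range f = LinearMap.ker ((cpx X).d i (i + 1)).hom := by
    have := (X.property i).1
    obtain ⟨n, f, hf⟩ := Module.Finite.exists_fin' A (LinearMap.ker ((cpx X).d i (i + 1)).hom)
    refine ⟨n, (Submodule.subtype _) ∘ₗ f, ?_⟩
    rw [LinearMap.range_comp, LinearMap.range_eq_top.2 hf, Submodule.map_top,
      Submodule.range_subtype]
  choose n f hf using key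
  let K : CochainComplex (ModuleCat.{u} A) ℤ :=
    { X := fun i => ModuleCat.of A (Fin (n i) → A)
      d := fun _ _ => 0 }
  let P : KProj A := ⟨(HomotopyCategory.quotient _ _).obj K, fun i =>
    ⟨inferInstanceAs (Module.Finite A (Fin (n i) → A)),
      inferInstanceAs (Module.Projective A (Fin (n i) → A))⟩⟩
  have hfd (i : ℤ) (v : Fin (n i) → A) : ((cpx X).d i (i + 1)).hom (f i v) = 0 := by
    have : f i v ∈ LinearMap.ker ((cpx X).d i (i + 1)).hom := hf i ▸ ⟨v, rfl⟩
    exact this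
  let F : cpx P ⟶ cpx X :=
    { f := fun i => ModuleCat.ofHom (X := Fin (n i) → A) (f i)
      comm' := by
        rintro i _ rfl
        refine Eq.trans ?_ zero_comp.symm
        ext v
        exact hfd i _ }
  refine ⟨P, F, ⟨fun _ => 0, fun i => by rw [zero_comp, comp_zero]; rfl⟩, fun j z hz => ?_⟩
  have : z ∈ LinearMap.range (f j) := (hf j).symm ▸ hz
  obtain ⟨v, rfl⟩ := this
  exact ⟨v, rfl, 0, by rw [map_zero, add_zero]; rfl⟩

end Split

/-! ### The category `Add` and approximations -/

section Lifting

variable {A : Type u} [Ring A]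

lemma CohSurjective.shift {Y Z : KProj A} {g : Y ⟶ Z} (hg : CohSurjective g) (n : ℤ) :
    CohSurjective (g⟦n⟧') := by
  intro i
  have e : shiftFunctor (KProj A) n ⋙ cohomology A i ≅ cohomology A (n + i) :=
    (Functor.associator _ _ _).symm ≪≫
      Functor.isoWhiskerRight ((projComplexes A).ι.commShiftIso n) _ ≪≫
      Functor.associator _ _ _ ≪≫ Functor.isoWhiskerLeft _
        ((HomotopyCategory.homologyFunctor (ModuleCat.{u} A) (ComplexShape.up ℤ) 0).shiftIso
          n i (n + i) rfl)
  have := hg (n + i)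
  rw [← ModuleCat.epi_iff_surjective] at this ⊢
  exact ((MorphismProperty.epimorphisms (ModuleCat.{u} A)).arrow_mk_iso_iff
    (((Functor.mapArrowFunctor _ _).mapIso e).app (Arrow.mk g))).2 this

/-- Objects with the left lifting property for cohomologically surjective morphisms. -/
def LiftsCohSurjective (W : KProj A) : Prop :=
  ∀ ⦃Y Z : KProj A⦄ (g : Y ⟶ Z), CohSurjective g → ∀ w : W ⟶ Z, ∃ t : W ⟶ Y, t ≫ g = w

lemma LiftsCohSurjective.shift {W : KProj A} (hW : LiftsCohSurjective W) (n : ℤ) :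
    LiftsCohSurjective (W⟦n⟧) := by
  intro Y Z g hg w
  obtain ⟨u, hu⟩ := hW (g⟦-n⟧') (hg.shift (-n)) ((shiftShiftNeg W n).inv ≫ w⟦-n⟧')
  obtain ⟨t, ht⟩ := (shiftFunctor (KProj A) (-n)).map_surjective ((shiftShiftNeg W n).hom ≫ u)
  refine ⟨t, (shiftFunctor (KProj A) (-n)).map_injective ?_⟩
  rw [Functor.map_comp, ht, Category.assoc, hu, Iso.hom_inv_id_assoc]

/-- The lifting property holds for the regular module, whose maps compute `H⁰`, and passes to
shifts, retracts and coproducts; minimality of `Add` does the rest. No description of the coproducts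
in the homotopy category is needed. -/
lemma IsAdd.liftsCohSurjective {W : KProj A} (hW : IsAdd W) : LiftsCohSurjective W := by
  refine hW LiftsCohSurjective ?_ (fun W n h => h.shift n) ?_ ?_
  · intro Y Z g hg w
    obtain ⟨g, rfl⟩ := ofChainMap_surjective g
    exact exists_lift_of_surjectiveOnCohomologyAt g 0
      ((cohSurjective_ofChainMap_iff g).1 hg 0) w
  · rintro W W' ⟨r⟩ h Y Z g hg w
    obtain ⟨t, ht⟩ := h g hg (r.r ≫ w)
    exact ⟨r.i ≫ t, by rw [Category.assoc, ht, r.retract_assoc]⟩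
  · rintro J F c ⟨hc⟩ h Y Z g hg w
    choose t ht using fun j => h j g hg (c.inj j ≫ w)
    refine ⟨Cofan.IsColimit.desc hc t, Cofan.IsColimit.hom_ext hc _ _ fun j => ?_⟩
    rw [Cofan.IsColimit.fac_assoc, ht]

/-- The identity lifts through a split cover, so `X` is a retract of a split complex. -/
lemma IsAdd.isFGProj_cok [IsNoetherianRing A] {X : KProj A} (hX : IsAdd X) (i : ℤ) :
    IsFGProj (cok X i) := by
  obtain ⟨P, f, hP, hf⟩ := exists_split_cover X
  obtain ⟨t, ht⟩ := hX.liftsCohSurjective (ofChainMap f)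
    ((cohSurjective_ofChainMap_iff f).2 hf) (𝟙 X)
  exact isStableProperty_isFGProj.cok_of_retract ⟨t, _, ht⟩ i (hP.isFGProj_cok i)

lemma IsRightAddApprox.cohSurjective {P X : KProj A} {p : P ⟶ X} (hp : IsRightAddApprox p) :
    CohSurjective p := by
  obtain ⟨p, rfl⟩ := ofChainMap_surjective p
  exact (cohSurjective_ofChainMap_iff p).2 fun k =>
    surjectiveOnCohomologyAt_of_lift p k (hp.2 _ (isAdd_stalk k))

end Lifting

/-! ### Projective dimension of complexes -/

section ProjectiveDimension

variable {A : Type u} [Ring A]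

lemma IsStableProperty.cok_coneObj_iff {P : ModuleCat.{u} A → Prop} (hP : IsStableProperty P)
    {X Y Z : KProj A} (g : cpx Y ⟶ cpx Z) {f : X ⟶ Y} {h : Z ⟶ X⟦(1 : ℤ)⟧}
    (hT : Triangle.mk f (ofChainMap g) h ∈ distTriang (KProj A)) (i : ℤ) :
    P (cok (coneObj g) i) ↔ P (cok X (i + 1)) := by
  obtain ⟨e⟩ := nonempty_shift_iso_coneObj g hT
  rw [← hP.cok_iff_of_iso e, hP.cok_shift_iff]

lemma IsFGProj.hasProjectiveDimensionLT {P : ModuleCat.{u} A} (hP : IsFGProj P) (n : ℕ)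
    (hn : 1 ≤ n) : HasProjectiveDimensionLT P n := by
  have := projective_of_isFGProj hP
  exact hasProjectiveDimensionLT_of_ge P 1 n hn

lemma isStableProperty_hasProjectiveDimensionLE (n : ℕ) :
    IsStableProperty (fun M : ModuleCat.{u} A => HasProjectiveDimensionLE M n) where
  of_retract r h := r.hasProjectiveDimensionLT (n + 1)
  biprod {M F} h hF := by
    have := hF.hasProjectiveDimensionLT (n + 1) (by lia)
    change HasProjectiveDimensionLT _ _
    change HasProjectiveDimensionLT _ _ at h
    infer_instance

/-- In the sequence `0 → Cⁱ(cone f) → Cⁱ⁺¹(P) ⊞ Xⁱ⁺¹ → Cⁱ⁺¹(X) → 0` the middle term is projective,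
so each triangle of the resolution costs one dimension. -/
lemma hasProjectiveDimensionLE_cok_of_complexPdLE (n : ℕ) :
    ∀ X : KProj A, ComplexPdLE X n → ∀ i, HasProjectiveDimensionLE (cok X i) n := by
  induction n with
  | zero =>
    rintro X ⟨Y, -, ⟨e⟩, hY, -⟩ i
    rw [← (isStableProperty_hasProjectiveDimensionLE 0).cok_iff_of_iso e]
    have := projective_of_isFGProj (hY.isFGProj_cok i)
    exact (projective_iff_hasProjectiveDimensionLE_zero _).1 this
  | succ n ih =>
    rintro X ⟨Y, P, ⟨e⟩, hY, hYP⟩ i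
    rw [← (isStableProperty_hasProjectiveDimensionLE (n + 1)).cok_iff_of_iso e]
    have hY₁ := ih (Y 1) ⟨fun i => Y (i + 1), fun i => P (i + 1), ⟨Iso.refl _⟩, hY,
      fun i hi => hYP (i + 1) (by lia)⟩
    obtain ⟨hP, a, f, h, hT, hf⟩ := hYP 0 n.succ_pos
    obtain ⟨f, rfl⟩ := ofChainMap_surjective f
    obtain ⟨j, rfl⟩ : ∃ j, i = j + 1 := ⟨i - 1, by lia⟩
    have hS := cokCone_shortExact f j ((cohSurjective_ofChainMap_iff f).1 hf j)
    have h₁ := ((isStableProperty_hasProjectiveDimensionLE n).cok_coneObj_iff f hT j).2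
      (hY₁ (j + 1))
    exact hS.hasProjectiveDimensionLT_X₃ (n + 1) h₁
      (((hP.isFGProj_cok (j + 1)).biprod ((Y 0).property (j + 1))).hasProjectiveDimensionLT
        (n + 1 + 1) (by lia))

lemma complexPdLE_of_hasProjectiveDimensionLE [IsNoetherianRing A] (n : ℕ) :
    ∀ X : KProj A, (∀ i, HasProjectiveDimensionLE (cok X i) n) → ComplexPdLE X n := by
  induction n with
  | zero =>
    intro X hX
    exact ⟨fun _ => X, fun _ => X, ⟨Iso.refl _⟩, isSplitComplex_of_projective_cok fun i =>
      (projective_iff_hasProjectiveDimensionLE_zero _).2 (hX i), fun i hi => by lia⟩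
  | succ n ih =>
    intro X hX
    obtain ⟨P, f, hP, hf⟩ := exists_split_cover X
    obtain ⟨W, a, h, hT⟩ := distinguished_cocone_triangle₁ (ofChainMap f)
    obtain ⟨Y, Q, ⟨e⟩, hY, hYQ⟩ := ih W (by
      intro i
      obtain ⟨j, rfl⟩ : ∃ j, i = j + 1 := ⟨i - 1, by lia⟩
      rw [← (isStableProperty_hasProjectiveDimensionLE n).cok_coneObj_iff f hT j]
      have hS := cokCone_shortExact f j (hf j)
      exact hS.hasProjectiveDimensionLT_X₁ (n + 1)
        (((hP.isFGProj_cok (j + 1)).biprod (X.property (j + 1))).hasProjectiveDimensionLT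
          (n + 1) (by lia)) (hX (j + 1)))
    refine ⟨fun i => Nat.casesOn i X Y, fun i => Nat.casesOn i P Q, ⟨Iso.refl _⟩, hY, ?_⟩
    rintro (_ | i) hi
    -- The resolution of `W` starts at an object only isomorphic to `W`, so the triangle is
    -- transported along `e`.
    · refine ⟨hP, e.hom ≫ a, ofChainMap f, h ≫ e.inv⟦1⟧', ?_,
        (cohSurjective_ofChainMap_iff f).2 hf⟩
      refine isomorphic_distinguished _ hT _
        (Triangle.isoMk _ _ e (Iso.refl _) (Iso.refl _) ?_ ?_ ?_)
      · exact Category.comp_id _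
      · exact (Category.comp_id _).trans (Category.id_comp _).symm
      · change (h ≫ e.inv⟦1⟧') ≫ e.hom⟦1⟧' = 𝟙 _ ≫ h
        rw [Category.assoc, ← Functor.map_comp, e.inv_hom_id,
          CategoryTheory.Functor.map_id, Category.comp_id, Category.id_comp]
    · exact hYQ i (by lia)

lemma complexPdLE_iff [IsNoetherianRing A] (X : KProj A) (n : ℕ) :
    ComplexPdLE X n ↔ ∀ i, HasProjectiveDimensionLE (cok X i) n :=
  ⟨hasProjectiveDimensionLE_cok_of_complexPdLE n X,
    complexPdLE_of_hasProjectiveDimensionLE n X⟩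

lemma complexPd_le_iff [IsNoetherianRing A] (X : KProj A) (n : ℕ) :
    complexPd X ≤ n ↔ ∀ i, HasProjectiveDimensionLE (cok X i) n := by
  rw [← complexPdLE_iff]
  refine sInf_coe_le_iff (p := ComplexPdLE X) (fun k m hkm hk => ?_) n
  rw [complexPdLE_iff] at hk ⊢
  intro i
  have := hk i
  exact hasProjectiveDimensionLT_of_ge _ (k + 1) (m + 1) (by lia)

theorem complexPd_eq_iSup [IsNoetherianRing A] (X : KProj A) :
    complexPd X = ⨆ i : ℤ, modulePd (cok X i) := by
  -- Two extended naturals with the same finite upper bounds are equal.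
  have key (n : ℕ) : complexPd X ≤ n ↔ ⨆ i : ℤ, modulePd (cok X i) ≤ n := by
    rw [complexPd_le_iff, iSup_le_iff]
    refine forall_congr' fun i => ?_
    rw [modulePd_le_iff]
    exact ⟨fun h => ⟨cok_finite X i, h⟩, fun h => h.2⟩
  apply le_antisymm
  · generalize hb : ⨆ i : ℤ, modulePd (cok X i) = b at key ⊢
    induction b using ENat.recTopCoe with
    | top => exact le_top
    | coe n => exact (key n).2 le_rfl
  · generalize hb : complexPd X = b at key ⊢
    induction b using ENat.recTopCoe with
    | top => exact le_top
    | coe n => exact (key n).1 le_rfl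

end ProjectiveDimension

/-! ### Gorenstein projective complexes -/

section GorensteinProjective

variable {A B D : Type u} [Ring A] [Ring B] [AddCommGroup D] [Module A D] [Module B D]
  [SMulCommClass A B D] [Module.Finite B D] [Module.Projective B D]

lemma isStableProperty_totallyReflexive (hAB : EndBijective A B D) :
    IsStableProperty (TotallyReflexive A B D) where
  of_retract r h := h.of_retract r
  biprod {M F} h hF := TotallyReflexive.middle
    (ShortComplex.Splitting.ofHasBinaryBiproduct M F).shortExact h (.of_isFGProj hAB hF)

/-- With `Z` the image of `Xⁱ → Xⁱ⁺¹`, use `0 → Z → Xⁱ⁺¹ → Cⁱ⁺¹ → 0` and then `0 → Hⁱ → Cⁱ → Z → 0`;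
kernels of surjections between totally reflexive modules are totally reflexive. -/
lemma TotallyReflexive.homology [IsNoetherianRing A] (hAB : EndBijective A B D) {X : KProj A}
    {i : ℤ} (h₀ : TotallyReflexive A B D (cok X i))
    (h₁ : TotallyReflexive A B D (cok X (i + 1))) :
    TotallyReflexive A B D ((cpx X).homology i) := by
  let K := cpx X
  have hK := isStableProperty_totallyReflexive hAB
  have := (X.property (i + 1)).1
  have := h₀.finite
  let Z := ModuleCat.of A (LinearMap.ker (cokπ X (i + 1)).hom)
  have hZ : TotallyReflexive A B D Z :=
    TotallyReflexive.left (kerShortComplex_shortExact _ (cokπ_surjective X (i + 1)))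
      (inferInstanceAs (Module.Finite A (LinearMap.ker (cokπ X (i + 1)).hom)))
      (.of_isFGProj hAB (X.property (i + 1))) h₁
  let e : K.opcycles i ≅ cok X i :=
    (K.opcyclesIsCokernel (i - 1) i ((ComplexShape.up ℤ).prev_eq' (sub_add_cancel i 1))
      ).coconePointUniqueUpToIso (colimit.isColimit _)
  have hO := hK.of_iso e h₀
  have hp (x : K.X i) : (K.fromOpcycles i (i + 1)).hom ((K.pOpcycles i).hom x) =
      (K.d i (i + 1)).hom x :=
    LinearMap.congr_fun (congrArg ModuleCat.Hom.hom (K.p_fromOpcycles i (i + 1))) x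
  have hps : Function.Surjective (K.pOpcycles i).hom :=
    (ModuleCat.epi_iff_surjective _).1 inferInstance
  let g : K.opcycles i ⟶ Z := ModuleCat.ofHom
    ((K.fromOpcycles i (i + 1)).hom.codRestrict (LinearMap.ker (cokπ X (i + 1)).hom) fun c => by
      obtain ⟨x, rfl⟩ := hps c
      rw [hp]
      exact (exact_d_cokπ X rfl).apply_apply_eq_zero x)
  have hex : Function.Exact (K.homologyι i).hom (K.fromOpcycles i (i + 1)).hom :=
    (ShortComplex.ShortExact.moduleCat_exact_iff_function_exact _).1
      (ShortComplex.exact_of_f_is_kernel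
        (ShortComplex.mk _ _ (K.homologyι_comp_fromOpcycles i (i + 1)))
        (K.homologyIsKernel i (i + 1) ((ComplexShape.up ℤ).next_eq' rfl)))
  have hex' : Function.Exact (K.homologyι i).hom g.hom := fun x => by
    rw [← hex x]
    exact ⟨fun h => congrArg Subtype.val h, fun h => Subtype.ext h⟩
  have hinj : Function.Injective (K.homologyι i).hom :=
    (ModuleCat.mono_iff_injective _).1 inferInstance
  have hsurj : Function.Surjective g.hom := by
    rintro ⟨z, hz⟩
    obtain ⟨x, rfl⟩ := (exact_d_cokπ X rfl z).1 hz
    exact ⟨(K.pOpcycles i).hom x, Subtype.ext (hp x)⟩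
  have := hO.finite
  exact TotallyReflexive.left (S := ShortComplex.mk (K.homologyι i) g
      (by ext x; exact congrArg Subtype.val (hex'.apply_apply_eq_zero x)))
    (shortExact_of_maps hinj hex' hsurj) (Module.Finite.of_injective _ hinj) hO hZ

section Triangles

variable {X Y Z : KProj A} {f : X ⟶ Y} {g : Y ⟶ Z} {h : Z ⟶ X⟦(1 : ℤ)⟧}
  (hT : Triangle.mk f g h ∈ distTriang (KProj A)) (hg : CohSurjective g)
  (hAB : EndBijective A B D)

include hT hg hAB

lemma totallyReflexive_cok_left_of_triangle (hY : ∀ i, TotallyReflexive A B D (cok Y i))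
    (hZ : ∀ i, TotallyReflexive A B D (cok Z i)) (i : ℤ) :
    TotallyReflexive A B D (cok X i) := by
  obtain ⟨g, rfl⟩ := ofChainMap_surjective g
  obtain ⟨j, rfl⟩ : ∃ j, i = j + 1 := ⟨i - 1, by lia⟩
  have hP := isStableProperty_totallyReflexive hAB
  rw [← hP.cok_coneObj_iff g hT j]
  exact TotallyReflexive.left
    (cokCone_shortExact g j ((cohSurjective_ofChainMap_iff g).1 hg j))
    (cok_finite _ _) (hP.biprod (hY (j + 1)) (Z.property (j + 1))) (hZ (j + 1))

lemma totallyReflexive_cok_middle_of_triangle (hX : ∀ i, TotallyReflexive A B D (cok X i))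
    (hZ : ∀ i, TotallyReflexive A B D (cok Z i)) (i : ℤ) :
    TotallyReflexive A B D (cok Y i) := by
  obtain ⟨g, rfl⟩ := ofChainMap_surjective g
  obtain ⟨j, rfl⟩ : ∃ j, i = j + 1 := ⟨i - 1, by lia⟩
  have hP := isStableProperty_totallyReflexive hAB
  have h₂ := TotallyReflexive.middle
    (cokCone_shortExact g j ((cohSurjective_ofChainMap_iff g).1 hg j))
    ((hP.cok_coneObj_iff g hT j).2 (hX (j + 1))) (hZ (j + 1))
  exact hP.of_retract (N := cok Y (j + 1) ⊞ (cpx Z).X (j + 1))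
    ⟨biprod.inl, biprod.fst, biprod.inl_fst⟩ h₂

end Triangles

/-- The approximation supplies the extension of functionals that the cokernel case of
two-out-of-three requires. The isomorphism `e` translates between functionals into `D` and maps to
stalk complexes of `A`. -/
lemma totallyReflexive_cok_coneObj (hAB : EndBijective A B D) (e : D ≃ₗ[A] A) {X Q : KProj A}
    (q : cpx X ⟶ cpx Q) (hq : IsLeftAddApprox (ofChainMap q)) (i : ℤ)
    (hX : TotallyReflexive A B D (cok X i)) (hQ : TotallyReflexive A B D (cok Q i)) :
    TotallyReflexive A B D (cok (coneObj q) i) := by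
  have hP := isStableProperty_totallyReflexive hAB
  have hex := exact_cokToBiprod_biprodToCokCone q i
  have hD (φ : cok X i →ₗ[A] D) : ∃ ψ : (cok Q i ⊞ (cpx X).X (i + 1) : ModuleCat.{u} A) →ₗ[A] D,
      ψ ∘ₗ (cokToBiprod q i).hom = φ := by
    obtain ⟨ψ, k, hψ, hk⟩ := exists_factorization_of_isLeftAddApprox q hq i
      (e.toLinearMap ∘ₗ φ ∘ₗ (cokπ X i).hom) (fun y => by
        change e (φ ((cokπ X i).hom _)) = 0
        rw [(exact_d_cokπ X (sub_add_cancel i 1)).apply_apply_eq_zero, map_zero, map_zero])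
    let ψ' : cok Q i ⟶ ModuleCat.of A D := cokDesc Q i
      (ModuleCat.ofHom (e.symm.toLinearMap ∘ₗ ψ)) (by
        ext y
        exact (congrArg e.symm (hψ y)).trans e.symm.map_zero)
    -- The sign compensates for `-d` in the second component of `cokToBiprod`.
    let k' : (cpx X).X (i + 1) ⟶ ModuleCat.of A D :=
      ModuleCat.ofHom (-(e.symm.toLinearMap ∘ₗ k))
    refine ⟨(biprod.desc ψ' k').hom, ?_⟩
    ext c
    obtain ⟨x, rfl⟩ := cokπ_surjective X i c
    refine (biprod_desc_apply _ _ _).trans ?_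
    rw [cokToBiprod_fst, cokToBiprod_snd, cokDesc_apply]
    change e.symm (ψ ((q.f i).hom x)) + -e.symm (k (-((cpx X).d i (i + 1)).hom x)) = _
    rw [map_neg, map_neg, neg_neg, ← map_add, ← hk]
    exact e.symm_apply_apply _
  -- Functionals separate the points of the reflexive module `Cⁱ(X)`, and all of them factor through
  -- this map.
  have hinj : Function.Injective (cokToBiprod q i).hom := by
    intro c c' hc
    apply hX.bijective.1
    refine LinearMap.ext fun (φ : cok X i →ₗ[A] D) => ?_
    obtain ⟨ψ, rfl⟩ := hD φ
    exact congrArg ψ hc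
  exact TotallyReflexive.right (S := ShortComplex.mk (cokToBiprod q i) (biprodToCokCone q i)
      (by ext x; exact hex.apply_apply_eq_zero x))
    (shortExact_of_maps hinj hex (biprodToCokCone_surjective q i)) hX
    (hP.biprod hQ (X.property (i + 1))) hD

/-- The differential of `X*` into degree `i` is the dual of `X⁻ⁱ → X¹⁻ⁱ`, which presents `C¹⁻ⁱ(X)`.
-/
lemma isTranspose_cok_dual (X : KProj A) (i : ℤ) :
    IsTranspose A B D (cok X (-(i - 1))) (cok (dual A B D X) i) :=
  ⟨_, _, (cpx X).d (-i) (-(i - 1)), cokπ X (-(i - 1)), X.property _, X.property _,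
    cokπ_surjective X _, exact_d_cokπ X (by lia), ⟨Iso.refl _⟩⟩

end GorensteinProjective

end StableComplex

end

/-! ### The proposition -/

open StableComplex
theorem proposition5p9 (R : Type u) [Ring R] [IsNoetherianRing R] [IsNoetherianRing Rᵐᵒᵖ] :
    -- (1)
    (∀ X : KProj Rᵐᵒᵖ, complexPd X = ⨆ i : ℤ, modulePd (cok X i)) ∧
    -- (2)
    (∀ X : KProj Rᵐᵒᵖ, IsGorensteinProjective Rᵐᵒᵖ R R X →
      ∀ i : ℤ, IsGorensteinProjectiveModule Rᵐᵒᵖ R R ((cohomology Rᵐᵒᵖ i).obj X)) ∧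
    -- (3-a)
    (∀ X : KProj Rᵐᵒᵖ, IsSplitComplex X → IsGorensteinProjective Rᵐᵒᵖ R R X) ∧
    -- (3-b)
    (∀ X Y : KProj Rᵐᵒᵖ, IsGorensteinProjective Rᵐᵒᵖ R R X → Nonempty (Retract Y X) →
      IsGorensteinProjective Rᵐᵒᵖ R R Y) ∧
    -- (3-c)
    (∀ (X : KProj Rᵐᵒᵖ) (n : ℤ), IsGorensteinProjective Rᵐᵒᵖ R R X →
      IsGorensteinProjective Rᵐᵒᵖ R R (X⟦n⟧)) ∧
    -- (3-d)
    (∀ X : KProj Rᵐᵒᵖ, IsGorensteinProjective Rᵐᵒᵖ R R X →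
      (∀ W : KProj Rᵐᵒᵖ, IsSyzygy X W → IsGorensteinProjective Rᵐᵒᵖ R R W) ∧
      IsGorensteinProjective R Rᵐᵒᵖ R (dual Rᵐᵒᵖ R R X) ∧
      (∀ W : KProj Rᵐᵒᵖ, IsCosyzygy X W → IsGorensteinProjective Rᵐᵒᵖ R R W)) ∧
    -- (3-e)
    (∀ (X Y Z : KProj Rᵐᵒᵖ) (f : X ⟶ Y) (g : Y ⟶ Z) (h : Z ⟶ X⟦(1 : ℤ)⟧),
      IsCohGhostTriangle f g h → IsGorensteinProjective Rᵐᵒᵖ R R Z →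
      (IsGorensteinProjective Rᵐᵒᵖ R R X ↔ IsGorensteinProjective Rᵐᵒᵖ R R Y)) := by
  have hAB := endBijective_op_self R
  have hP := isStableProperty_totallyReflexive hAB
  have hgp (X : KProj Rᵐᵒᵖ) : IsGorensteinProjective Rᵐᵒᵖ R R X ↔
      ∀ i, TotallyReflexive Rᵐᵒᵖ R R (cok X i) :=
    forall_congr' fun i => isGorensteinProjectiveModule_iff hAB _
  refine ⟨complexPd_eq_iSup, ?_, ?_, ?_, ?_, ?_, ?_⟩
  · intro X hX i
    rw [hgp] at hX
    rw [isGorensteinProjectiveModule_iff hAB]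
    exact hP.of_iso ((HomotopyCategory.homologyFunctorFactors (ModuleCat.{u} Rᵐᵒᵖ)
      (ComplexShape.up ℤ) i).app (cpx X)) ((hX i).homology hAB (hX (i + 1)))
  · intro X hX
    rw [hgp]
    exact fun i => .of_isFGProj hAB (hX.isFGProj_cok i)
  · rintro X Y hX ⟨r⟩
    rw [hgp] at hX ⊢
    exact fun i => hP.cok_of_retract r i (hX i)
  · intro X n hX
    rw [hgp] at hX ⊢
    exact fun i => (hP.cok_shift_iff X n i).2 (hX (i + n))
  · intro X hX
    refine ⟨?_, fun i => (isTranspose_cok_dual X i).isGorensteinProjectiveModule hAB (hX _), ?_⟩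
    · rintro W ⟨P, p, hp, a, h, hT⟩
      rw [hgp] at hX ⊢
      exact totallyReflexive_cok_left_of_triangle hT hp.cohSurjective hAB
        (fun i => .of_isFGProj hAB (hp.1.isFGProj_cok i)) hX
    · rintro W ⟨Q, q, hq, b, h, hT⟩
      rw [hgp] at hX ⊢
      obtain ⟨q, rfl⟩ := ofChainMap_surjective q
      obtain ⟨e⟩ := nonempty_iso_coneObj q hT
      exact fun i => (hP.cok_iff_of_iso e i).2
        (totallyReflexive_cok_coneObj hAB (selfEquivOp R).symm q hq i (hX i)
          (.of_isFGProj hAB (hq.1.isFGProj_cok i)))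
  · rintro X Y Z f g h ⟨hT, hS⟩ hZ
    rw [hgp] at hZ ⊢
    rw [hgp]
    have hg : CohSurjective g := fun i => (hS i).2.2
    exact ⟨fun hX => totallyReflexive_cok_middle_of_triangle hT hg hAB hX hZ,
      fun hY => totallyReflexive_cok_left_of_triangle hT hg hAB hY hZ⟩
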